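/- Let $\Sigma$ be a connected smooth surface (a $2$-manifold without boundary) with a smooth immersion $i:\Sigma\to\mathbb{R}^4$, identify $T_p\Sigma$ with the plane $di_p(T_p\Sigma)\subset\mathbb{R}^4$, and let $\Pi\subset\mathbb{R}^4$ be a two-dimensional linear subspace. The principal angles $0\le\theta_1\le\theta_2\le\pi/2$ between two planes $V,W$ are defined by $\cos\theta_1=\langle v_1,w_1\rangle=\max\{\langle v,w\rangle: v\in V,\ w\in W,\ |v|=|w|=1\}$ and $\cos\theta_2=\max\{\langle v,w\rangle: v\in V,\ w\in W,\ v\perp v_1,\ w\perp w_1,\ |v|=|w|=1\}$. Assume that there are constants $0<\theta_1<\theta_2<\pi/2$ which, for every $p\in\Sigma$, are the principal angles between $T_p\Sigma$ and $\Pi$. Let $\alpha$ be the second fundamental form of $\Sigma$, $\nabla$ the Levi-Civita connection of the induced metric, and $N_1(p)=\mathrm{span}\{\alpha(X,Y): X,Y\in T_p\Sigma\}$ the first normal space at $p$. Let $S_p$ be the symmetric endomorphism of $T_p\Sigma$ with $\langle S_pv,v'\rangle=\langle p_\Pi(v),p_\Pi(v')\rangle$, where $p_\Pi$ is the orthogonal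 projection onto $\Pi$; its eigenvalues are $\cos^2\theta_1$ and $\cos^2\theta_2$. For $j=1,2$ let $T_j$ be the smooth unit tangent vector field with $S T_j=\cos^2\theta_j\,T_j$, which is defined locally and up to sign. Assume that $\Sigma$ has no totally geodesic point, that is, $N_1(p)\neq 0$ for every $p\in\Sigma$. Then the following are equivalent: (i) $\Sigma$ is (locally) a composition in the sense of Dajczer, do Carmo and Tojeiro: every point of $\Sigma$ lies in the image of a smooth map $\varphi:U\to\Sigma$, with $U\subset\mathbb{R}^2$ open, such that $i\circ\varphi:U\to\mathbb{R}^4$ is an isometric immersion and $i\circ\varphi=F\circ g$ for smooth isometric immersions $g:U\to W\subset\mathbb{R}^3$ and $F:W\to\mathbb{R}^4$, with $W$ open in $\mathbb{R}^3$; (ii) the first normal space has rank one: $\dim N_1(p)=1$ for every $p\in\Sigma$; (iii) $T_1$ or $T_2$ is a geodesic vector field: $\nabla_{T_1}T_1=0$ on all of $\Sigma$, or $\nabla_{T_2}T_2=0$ on all of $\Sigma$. -/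

import Mathlib

open scoped Manifold ContDiff Topology RealInnerProductSpace

noncomputable section

/-- Euclidean space of dimension `n`, with its standard inner product. -/
abbrev Euc (n : ℕ) : Type := EuclideanSpace ℝ (Fin n)

/-! ### Principal angles between two planes of `ℝ⁴` -/

/-- `θ₁ ≤ θ₂` are the principal angles between the planes `V` and `W`:
`cos θ₁ = ⟪v₁, w₁⟫` is the maximum of `⟪v, w⟫` over unit vectors `v ∈ V`, `w ∈ W`, and `cos θ₂` is
the maximum of `⟪v, w⟫` over unit vectors `v ∈ V`, `w ∈ W` with `v ⟂ v₁` and `w ⟂ w₁`. -/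
def ArePrincipalAngles (V W : Submodule ℝ (Euc 4)) (θ₁ θ₂ : ℝ) : Prop :=
  0 ≤ θ₁ ∧ θ₁ ≤ θ₂ ∧ θ₂ ≤ Real.pi / 2 ∧
  ∃ v₁ ∈ V, ∃ w₁ ∈ W, ‖v₁‖ = 1 ∧ ‖w₁‖ = 1 ∧ ⟪v₁, w₁⟫ = Real.cos θ₁ ∧
    IsGreatest {c : ℝ | ∃ v ∈ V, ∃ w ∈ W, ‖v‖ = 1 ∧ ‖w‖ = 1 ∧ c = ⟪v, w⟫} (Real.cos θ₁) ∧
    IsGreatest {c : ℝ | ∃ v ∈ V, ∃ w ∈ W, ‖v‖ = 1 ∧ ‖w‖ = 1 ∧ ⟪v, v₁⟫ = 0 ∧ ⟪w, w₁⟫ = 0 ∧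
      c = ⟪v, w⟫} (Real.cos θ₂)

/-- The symmetric endomorphism `S_{WV}` of `V` representing the quadratic form `v ↦ ‖p_W v‖²`, where
`p_W` is the orthogonal projection onto `W`. -/
def angleOperator (W V : Submodule ℝ (Euc 4)) : V →ₗ[ℝ] V :=
  (V.orthogonalProjectionOnto : Euc 4 →ₗ[ℝ] V) ∘ₗ (W.starProjection : Euc 4 →ₗ[ℝ] Euc 4) ∘ₗ V.subtype

/-- The defining property of `S_{WV}`. -/
theorem inner_angleOperator (W V : Submodule ℝ (Euc 4)) (v v' : V) :
    ⟪angleOperator W V v, v'⟫ = ⟪W.starProjection (v : Euc 4), W.starProjection (v' : Euc 4)⟫ := by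
  rw [Submodule.inner_starProjection_left_eq_right,
    Submodule.starProjection_eq_self_iff.mpr (W.starProjection_apply_mem _)]
  simp [angleOperator, Submodule.inner_starProjection_left_eq_right]

/-! ### Immersed surfaces in `ℝ⁴` -/

section Surface

variable {M : Type*} [TopologicalSpace M] [ChartedSpace (Euc 2) M]

/-- A smooth immersion of the surface `M` into `ℝ⁴`. -/
structure IsSurfaceImmersion (i : M → Euc 4) : Prop where
  contMDiff : ContMDiff (𝓡 2) 𝓘(ℝ, Euc 4) ∞ i
  injective_mfderiv : ∀ p, Function.Injective (mfderiv (𝓡 2) 𝓘(ℝ, Euc 4) i p)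

/-- The differential at `p` of an `ℝ⁴`-valued map on the surface. -/
def surfDeriv (Y : M → Euc 4) (p : M) : Euc 2 →L[ℝ] Euc 4 :=
  mfderiv (𝓡 2) 𝓘(ℝ, Euc 4) Y p

/-- The tangent plane of the immersed surface at `p`, as a linear subspace of `ℝ⁴`. -/
def tangentPlane (i : M → Euc 4) (p : M) : Submodule ℝ (Euc 4) :=
  LinearMap.range (surfDeriv i p : Euc 2 →ₗ[ℝ] Euc 4)

/-- A smooth tangent vector field on the open set `V` of the surface, its values being viewed as
vectors of `ℝ⁴` through the differential of the immersion. -/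
structure IsTangentField (i : M → Euc 4) (V : Set M) (Y : M → Euc 4) : Prop where
  isOpen : IsOpen V
  contMDiffOn : ContMDiffOn (𝓡 2) 𝓘(ℝ, Euc 4) ∞ Y V
  mem_tangentPlane : ∀ q ∈ V, Y q ∈ tangentPlane i q

/-- The Levi-Civita derivative `∇_v Y` of the induced metric at `p`: the tangential part of the
Euclidean derivative of `Y` in the direction of the tangent vector `v` (of `M` at `p`). -/
def leviCivita (i : M → Euc 4) (Y : M → Euc 4) (p : M) (v : Euc 2) : Euc 4 :=
  (tangentPlane i p).starProjection (surfDeriv Y p v)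

/-- The second fundamental form `α(v, Y)` at `p`: the normal part of the Euclidean derivative
of the tangent field `Y` in the direction of the tangent vector `v` (of `M` at `p`). -/
def secondFundForm (i : M → Euc 4) (Y : M → Euc 4) (p : M) (v : Euc 2) : Euc 4 :=
  (tangentPlane i p)ᗮ.starProjection (surfDeriv Y p v)

/-- The first normal space `N₁(p)`: the span of all the values of the second fundamental form
at `p`. -/
def firstNormalSpace (i : M → Euc 4) (p : M) : Submodule ℝ (Euc 4) :=
  Submodule.span ℝ {w | ∃ (V : Set M) (Y : M → Euc 4) (v : Euc 2),
    p ∈ V ∧ IsTangentField i V Y ∧ w = secondFundForm i Y p v}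

/-- On `V`, the tangent field `T` is a field of unit eigenvectors of `S_{Π T_pΣ}` for the
eigenvalue `cos² θ`. For principal angles `θ₁ < θ₂ ≤ π/2` and `θ = θⱼ`, such fields exist near every
point and are unique up to sign on connected sets: they are the fields `Tⱼ`. -/
def IsPrincipalField (i : M → Euc 4) (P : Submodule ℝ (Euc 4)) (θ : ℝ) (V : Set M)
    (T : M → Euc 4) : Prop :=
  IsTangentField i V T ∧ ∀ q ∈ V, ‖T q‖ = 1 ∧
    ∃ h : T q ∈ tangentPlane i q,
      angleOperator P (tangentPlane i q) ⟨T q, h⟩ = (Real.cos θ) ^ 2 • ⟨T q, h⟩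

/-- On `V`, the tangent field `T` is geodesic: `∇_T T = 0`. -/
def IsGeodesicField (i : M → Euc 4) (V : Set M) (T : M → Euc 4) : Prop :=
  ∀ q ∈ V, ∀ v : Euc 2, surfDeriv i q v = T q → leviCivita i T q v = 0

/-- The principal direction field of the angle `θ`, which is defined locally and up to sign, is
geodesic. -/
def PrincipalDirectionGeodesic (i : M → Euc 4) (P : Submodule ℝ (Euc 4)) (θ : ℝ) : Prop :=
  ∀ p : M, ∃ (V : Set M) (T : M → Euc 4),
    p ∈ V ∧ IsPrincipalField i P θ V T ∧ IsGeodesicField i V T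

end Surface

/-! ### Compositions -/

/-- A smooth isometric immersion of the open subset `U` of `ℝᵐ` into `ℝⁿ`. -/
def IsIsometricImmersionOn {m n : ℕ} (f : Euc m → Euc n) (U : Set (Euc m)) : Prop :=
  IsOpen U ∧ ContDiffOn ℝ ∞ f U ∧ ∀ x ∈ U, ∀ u v, ⟪fderiv ℝ f x u, fderiv ℝ f x v⟫ = ⟪u, v⟫

/-- The isometric immersion `f : U ⊆ ℝ² → ℝ⁴` is a composition: `f = F ∘ g` for isometric immersions
`g : U → ℝ³` and `F : W ⊆ ℝ³ → ℝ⁴`. -/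
def IsCompositionOn (f : Euc 2 → Euc 4) (U : Set (Euc 2)) : Prop :=
  IsIsometricImmersionOn f U ∧
  ∃ (g : Euc 2 → Euc 3) (W : Set (Euc 3)) (F : Euc 3 → Euc 4),
    IsIsometricImmersionOn g U ∧ IsIsometricImmersionOn F W ∧ Set.MapsTo g U W ∧
    Set.EqOn f (F ∘ g) U

/-- The immersed surface is (locally) a composition: around every point it has a
parametrization `φ : U ⊆ ℝ² → M` for which `i ∘ φ` is an isometric immersion that is
a composition. -/
def IsSurfaceComposition {M : Type*} [TopologicalSpace M] [ChartedSpace (Euc 2) M]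
    (i : M → Euc 4) : Prop :=
  ∀ p : M, ∃ (U : Set (Euc 2)) (φ : Euc 2 → M),
    ContMDiffOn (𝓡 2) (𝓡 2) ∞ φ U ∧ p ∈ φ '' U ∧ IsCompositionOn (i ∘ φ) U

end

open scoped Manifold ContDiff Topology RealInnerProductSpace

noncomputable section

/-! ### Linear algebra of principal vectors -/

/-! Complete the principal unit vectors `T, T'` by unit normals `N, N'` so that `cos θ T - sin θ N`
and `cos θ' T' - sin θ' N'` form an orthonormal frame of `P`, while `sin θ T + cos θ N` and `sin θ'
T' + cos θ' N'` form one of `Pᗮ`. Since the angles are constant and both planes are fixed, each of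
these two frames turns by a single 1-form. The six connection forms of `T, T', N, N'` therefore
depend on two forms only, and `⟪dT, N⟫ = ⟪dT', N'⟫ = 0`. With the symmetry of the second fundamental
form this leaves two scalars: `α(T, T) = l N'`, `α(T', T') = m N`, `α(T, T') = 0`. As `cos² θ ≠ cos²
θ'`, the two rotation forms can be recovered from `l` and `m`, so the tangential and normal
connection forms are combinations of the curvature forms with constant coefficients `a, b`, both
nonzero (`AdaptedFrame.exists_structureEqs`). Hence `∇_T T = -a l T'`, so `T` is geodesic exactly
where `l = 0` (`ConstantAngles.geodesic_iff`), and `N₁` is spanned by `l N'` and `m N`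
(`ConstantAngles.firstNormalSpace_eq`). All three conditions thus concern the vanishing of `l` or
`m`.

Rank one gives a geodesic direction: exactly one of `l, m` vanishes at each point. The nonzero one
stays nonzero nearby, so the other vanishes nearby, and connectedness makes the choice global
(`ConstantAngles.geodesic_or`).

A geodesic direction gives a composition: if `l = 0`, the connection form `ω = ⟪T, dT'⟫` is closed
and the surface unrolls onto the plane. The normal part of `d(N' - a T')` cancels, so the lines
through the surface in the direction `N' - a T'` sweep out a flat hypersurface. This hypersurface
unrolls into `ℝ³` and carries the surface to a piece of a plane
(`AdaptedFrame.exists_isCompositionOn`).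

A composition has rank one: the second derivatives of `F` and of `g` add up to that of `f`, and by
the Gauss equation each is nonzero along at most one principal direction. If `l` and `m` were both
nonzero, one would come from `F` and the other from `g`. Differentiating once more then gives `a m²
= 0` or, with the roles exchanged, `b l² = 0` (`AdaptedFrame.false_of_nullity`). So `l m = 0`, and
since there is no totally geodesic point the rank is exactly one. -/

/-- An orthonormal pair in a plane spans it. -/
theorem eq_add_of_mem_plane {W : Submodule ℝ (Euc 4)} (hW : Module.finrank ℝ W = 2) {w w' : Euc 4}
    (hw : w ∈ W) (hw' : w' ∈ W) (h : ‖w‖ = 1) (h' : ‖w'‖ = 1) (hww' : ⟪w, w'⟫ = 0) {z : Euc 4}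
    (hz : z ∈ W) : z = ⟪w, z⟫ • w + ⟪w', z⟫ • w' := by
  have ho : Orthonormal ℝ ![w, w'] := by
    rw [orthonormal_vecCons_iff]
    simp [h, h', hww']
  have hle : Submodule.span ℝ {w, w'} ≤ W := by
    rw [Submodule.span_le]
    rintro _ (rfl | rfl) <;> assumption
  have hspan : Submodule.span ℝ {w, w'} = W := by
    refine Submodule.eq_of_le_of_finrank_eq hle ?_
    have := finrank_span_eq_card ho.linearIndependent
    rw [Matrix.range_cons_cons_empty] at this
    rw [this, hW]
    rfl
  rw [← hspan, Submodule.mem_span_pair] at hz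
  obtain ⟨a, b, rfl⟩ := hz
  have hw'w : ⟪w', w⟫ = 0 := by rw [real_inner_comm, hww']
  simp [inner_add_right, real_inner_smul_right, hww', hw'w, h, h']

/-- A unit vector of `W` maximising the inner product with `v` is parallel to the projection
of `v` on `W`. -/
theorem inner_eq_zero_of_isMax {W : Submodule ℝ (Euc 4)} {v w w' : Euc 4} (hw : w ∈ W)
    (hw' : w' ∈ W) (h : ‖w‖ = 1) (h' : ‖w'‖ = 1) (hww' : ⟪w', w⟫ = 0)
    (hmax : ∀ u ∈ W, ‖u‖ = 1 → ⟪v, u⟫ ≤ ⟪v, w⟫) : ⟪v, w'⟫ = 0 := by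
  set c := ⟪v, w⟫ with hc
  set a := ⟪v, w'⟫ with ha
  have hn : ‖c • w + a • w'‖ ^ 2 = c ^ 2 + a ^ 2 := by
    rw [norm_add_sq_real, norm_smul, norm_smul, real_inner_smul_left, real_inner_smul_right,
      real_inner_comm, hww', h, h']
    simp
  have hi : ⟪v, c • w + a • w'⟫ = c ^ 2 + a ^ 2 := by
    rw [inner_add_right, real_inner_smul_right, real_inner_smul_right, ← hc, ← ha]
    ring
  by_contra hne
  have hpos : 0 < c ^ 2 + a ^ 2 := by positivity
  have hr : 0 < ‖c • w + a • w'‖ := by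
    rw [← hn] at hpos
    exact pos_of_mul_pos_left (by rwa [sq] at hpos) (norm_nonneg _)
  -- The competitor is the normalised projection of `v` on the span of `w, w'`. Its inner product
  -- with `v` is `√(c² + a²)`, which exceeds `c` unless `a = 0`.
  have := hmax (‖c • w + a • w'‖⁻¹ • (c • w + a • w'))
    (W.smul_mem _ (W.add_mem (W.smul_mem _ hw) (W.smul_mem _ hw')))
    (by rw [norm_smul, norm_inv, norm_norm, inv_mul_cancel₀ hr.ne'])
  rw [real_inner_smul_right, hi, ← hn, sq, inv_mul_cancel_left₀ hr.ne'] at this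
  have h2 : ‖c • w + a • w'‖ ^ 2 ≤ c ^ 2 := by gcongr
  rw [hn] at h2
  have : 0 < a ^ 2 := by positivity
  linarith

/-- `v, v'` and `w, w'` are orthonormal pairs of principal vectors of `V` and `P`, for the
angles `θ` and `θ'`. -/
structure PrincipalVectors (V P : Submodule ℝ (Euc 4)) (θ θ' : ℝ) (v v' w w' : Euc 4) : Prop where
  mem : v ∈ V
  mem' : v' ∈ V
  memP : w ∈ P
  memP' : w' ∈ P
  norm : ‖v‖ = 1
  norm' : ‖v'‖ = 1
  normP : ‖w‖ = 1
  normP' : ‖w'‖ = 1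
  inner_V : ⟪v, v'⟫ = 0
  inner_P : ⟪w, w'⟫ = 0
  inner_cos : ⟪v, w⟫ = Real.cos θ
  inner_cos' : ⟪v', w'⟫ = Real.cos θ'
  inner_cross : ⟪v, w'⟫ = 0
  inner_cross' : ⟪v', w⟫ = 0

namespace PrincipalVectors

variable {V P : Submodule ℝ (Euc 4)} {θ θ' : ℝ} {v v' w w' : Euc 4}

theorem swap (h : PrincipalVectors V P θ θ' v v' w w') : PrincipalVectors V P θ' θ v' v w' w where
  mem := h.mem'
  mem' := h.mem
  memP := h.memP'
  memP' := h.memP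
  norm := h.norm'
  norm' := h.norm
  normP := h.normP'
  normP' := h.normP
  inner_V := by rw [real_inner_comm, h.inner_V]
  inner_P := by rw [real_inner_comm, h.inner_P]
  inner_cos := h.inner_cos'
  inner_cos' := h.inner_cos
  inner_cross := h.inner_cross'
  inner_cross' := h.inner_cross

theorem starProjection_left (h : PrincipalVectors V P θ θ' v v' w w')
    (hP : Module.finrank ℝ P = 2) : P.starProjection v = Real.cos θ • w := by
  have hz := eq_add_of_mem_plane hP h.memP h.memP' h.normP h.normP' h.inner_P
    (P.starProjection_apply_mem v)
  rw [← Submodule.inner_starProjection_left_eq_right,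
    Submodule.starProjection_eq_self_iff.mpr h.memP, ← Submodule.inner_starProjection_left_eq_right,
    Submodule.starProjection_eq_self_iff.mpr h.memP', real_inner_comm, h.inner_cos,
    real_inner_comm, h.inner_cross, zero_smul, add_zero] at hz
  exact hz

theorem inner_starProjection (h : PrincipalVectors V P θ θ' v v' w w')
    (hV : Module.finrank ℝ V = 2) (hP : Module.finrank ℝ P = 2) {x y : Euc 4} (hx : x ∈ V)
    (hy : y ∈ V) : ⟪P.starProjection x, P.starProjection y⟫ =
      Real.cos θ ^ 2 * ⟪v, x⟫ * ⟪v, y⟫ + Real.cos θ' ^ 2 * ⟪v', x⟫ * ⟪v', y⟫ := by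
  have hp := h.starProjection_left hP
  have hp' := h.swap.starProjection_left hP
  have ex := eq_add_of_mem_plane hV h.mem h.mem' h.norm h.norm' h.inner_V hx
  have ey := eq_add_of_mem_plane hV h.mem h.mem' h.norm h.norm' h.inner_V hy
  have hw := h.swap.inner_P
  conv_lhs => rw [ex, ey]
  simp only [map_add, map_smul, hp, hp', inner_add_left, inner_add_right, real_inner_smul_left,
    real_inner_smul_right, h.inner_P, hw, real_inner_self_eq_norm_sq, h.normP, h.normP']
  ring

end PrincipalVectors

/-- The cross terms vanish by the first-order condition: the first pair is maximal in each of its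
two entries separately, so `v` is orthogonal to `w'` and `w` to `v'`. -/
theorem ArePrincipalAngles.exists_principalVectors {V P : Submodule ℝ (Euc 4)} {θ θ' : ℝ}
    (h : ArePrincipalAngles V P θ θ') : ∃ v v' w w', PrincipalVectors V P θ θ' v v' w w' := by
  obtain ⟨-, -, -, v, hv, w, hw, nv, nw, hc, hmax, ⟨v', hv', w', hw', nv', nw', ov, ow, hc'⟩, -⟩ := h
  have hl : ∀ u ∈ P, ‖u‖ = 1 → ⟪v, u⟫ ≤ ⟪v, w⟫ := fun u hu nu ↦
    hc ▸ hmax.2 ⟨v, hv, u, hu, nv, nu, rfl⟩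
  have hr : ∀ u ∈ V, ‖u‖ = 1 → ⟪w, u⟫ ≤ ⟪w, v⟫ := fun u hu nu ↦ by
    rw [real_inner_comm v w, hc]
    exact hmax.2 ⟨u, hu, w, hw, nu, nw, real_inner_comm _ _⟩
  refine ⟨v, v', w, w', hv, hv', hw, hw', nv, nv', nw, nw', ?_, ?_, hc, hc'.symm, ?_, ?_⟩
  · rw [real_inner_comm, ov]
  · rw [real_inner_comm, ow]
  · exact inner_eq_zero_of_isMax hw hw' nw nw' ow hl
  · rw [real_inner_comm, inner_eq_zero_of_isMax hv hv' nv nv' ov hr]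

/-- An orthonormal frame `T, T', N, N'` of `ℝ⁴` adapted to the plane `V` and to its principal
directions with respect to the plane `P`. -/
structure PointFrame (V P : Submodule ℝ (Euc 4)) (θ θ' : ℝ) (T T' N N' : Euc 4) : Prop where
  mem : T ∈ V
  mem' : T' ∈ V
  memN : N ∈ Vᗮ
  memN' : N' ∈ Vᗮ
  norm : ‖T‖ = 1
  norm' : ‖T'‖ = 1
  normN : ‖N‖ = 1
  normN' : ‖N'‖ = 1
  inner_T : ⟪T, T'⟫ = 0
  inner_N : ⟪N, N'⟫ = 0
  mem_P : Real.cos θ • T - Real.sin θ • N ∈ P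
  mem_P' : Real.cos θ' • T' - Real.sin θ' • N' ∈ P
  mem_orth : Real.sin θ • T + Real.cos θ • N ∈ Pᗮ
  mem_orth' : Real.sin θ' • T' + Real.cos θ' • N' ∈ Pᗮ

/-- The normal vector of the adapted frame associated with the principal tangent vector `T`. -/
def principalNormal (P : Submodule ℝ (Euc 4)) (θ : ℝ) (T : Euc 4) : Euc 4 :=
  (Real.sin θ)⁻¹ • (Real.cos θ • T - (Real.cos θ)⁻¹ • P.starProjection T)

/-- `T` is a unit vector of `V` in the principal direction of angle `θ` with respect to `P`. -/
def IsPrincipalUnit (V P : Submodule ℝ (Euc 4)) (θ : ℝ) (T : Euc 4) : Prop :=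
  ‖T‖ = 1 ∧ ∃ h : T ∈ V, angleOperator P V ⟨T, h⟩ = (Real.cos θ) ^ 2 • ⟨T, h⟩

theorem PrincipalVectors.isPrincipalUnit {V P : Submodule ℝ (Euc 4)} {θ θ' : ℝ}
    {v v' w w' : Euc 4} (h : PrincipalVectors V P θ θ' v v' w w') (hV : Module.finrank ℝ V = 2)
    (hP : Module.finrank ℝ P = 2) {T : Euc 4} (hT : T ∈ V) (nT : ‖T‖ = 1) (h0 : ⟪v', T⟫ = 0) :
    IsPrincipalUnit V P θ T := by
  refine ⟨nT, hT, ext_inner_right ℝ fun z ↦ ?_⟩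
  rw [inner_angleOperator, h.inner_starProjection hV hP hT z.2, h0, Submodule.coe_inner,
    Submodule.coe_smul]
  have e := eq_add_of_mem_plane hV h.mem h.mem' h.norm h.norm' h.inner_V hT
  rw [h0, zero_smul, add_zero] at e
  have : ⟪T, (z : Euc 4)⟫ = ⟪v, T⟫ * ⟪v, (z : Euc 4)⟫ := by
    rw [← real_inner_smul_left, ← e]
  simp only [real_inner_smul_left, this]
  ring

/-- Eigenvectors of a symmetric operator for distinct eigenvalues are orthogonal: evaluate `⟪S T,
v'⟫` once by the eigenvalue equation of `T` and once by the diagonal form. -/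
theorem PrincipalVectors.inner_eq_zero {V P : Submodule ℝ (Euc 4)} {θ θ' : ℝ} {v v' w w' : Euc 4}
    (h : PrincipalVectors V P θ θ' v v' w w') (hV : Module.finrank ℝ V = 2)
    (hP : Module.finrank ℝ P = 2) (hθ : Real.cos θ ^ 2 ≠ Real.cos θ' ^ 2) {T : Euc 4}
    (hT : IsPrincipalUnit V P θ T) : ⟪v', T⟫ = 0 := by
  obtain ⟨nT, mT, e⟩ := hT
  have h1 := inner_angleOperator P V ⟨T, mT⟩ ⟨v', h.mem'⟩
  rw [e, h.inner_starProjection hV hP mT h.mem', h.inner_V, real_inner_self_eq_norm_sq, h.norm',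
    Submodule.coe_inner, Submodule.coe_smul, real_inner_smul_left] at h1
  simp only at h1
  rw [real_inner_comm] at h1
  have : (Real.cos θ ^ 2 - Real.cos θ' ^ 2) * ⟪v', T⟫ = 0 := by linarith
  exact (mul_eq_zero.mp this).resolve_left (sub_ne_zero.mpr hθ)

theorem PrincipalVectors.exists_eq_smul {V P : Submodule ℝ (Euc 4)} {θ θ' : ℝ} {v v' w w' : Euc 4}
    (h : PrincipalVectors V P θ θ' v v' w w') (hV : Module.finrank ℝ V = 2)
    (hP : Module.finrank ℝ P = 2) (hθ : Real.cos θ ^ 2 ≠ Real.cos θ' ^ 2) {T : Euc 4}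
    (hT : IsPrincipalUnit V P θ T) : ∃ ε : ℝ, ε ^ 2 = 1 ∧ T = ε • v := by
  have e := eq_add_of_mem_plane hV h.mem h.mem' h.norm h.norm' h.inner_V hT.2.1
  rw [h.inner_eq_zero hV hP hθ hT, zero_smul, add_zero] at e
  refine ⟨_, ?_, e⟩
  have := hT.1
  rw [e, norm_smul, h.norm, mul_one, Real.norm_eq_abs] at this
  rw [← sq_abs, this, one_pow]

/-- Principal units are unique up to sign, so `T = ε v` and `T' = δ v'` with `ε² = δ² = 1`, and the
first normal is `ε (cos θ v - w) / sin θ`. Every condition on the frame then follows from the Gram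
matrix of `v, v', w, w'`; in particular `cos θ T - sin θ N = ε w`. -/
theorem PrincipalVectors.pointFrame {V P : Submodule ℝ (Euc 4)} {θ θ' : ℝ} {v v' w w' : Euc 4}
    (h : PrincipalVectors V P θ θ' v v' w w') (hV : Module.finrank ℝ V = 2)
    (hP : Module.finrank ℝ P = 2) (hθ : Real.cos θ ^ 2 ≠ Real.cos θ' ^ 2)
    (hc : Real.cos θ ≠ 0) (hc' : Real.cos θ' ≠ 0) (hs : Real.sin θ ≠ 0) (hs' : Real.sin θ' ≠ 0)
    {T T' : Euc 4} (hT : IsPrincipalUnit V P θ T) (hT' : IsPrincipalUnit V P θ' T') :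
    PointFrame V P θ θ' T T' (principalNormal P θ T) (principalNormal P θ' T') := by
  obtain ⟨ε, hε, rfl⟩ := h.exists_eq_smul hV hP hθ hT
  obtain ⟨δ, hδ, rfl⟩ := h.swap.exists_eq_smul hV hP hθ.symm hT'
  have eN : principalNormal P θ (ε • v) = (ε * (Real.sin θ)⁻¹) • (Real.cos θ • v - w) := by
    rw [principalNormal, map_smul, h.starProjection_left hP]
    match_scalars <;> field_simp
  have eN' : principalNormal P θ' (δ • v') = (δ * (Real.sin θ')⁻¹) • (Real.cos θ' • v' - w') := by
    rw [principalNormal, map_smul, h.swap.starProjection_left hP]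
    match_scalars <;> field_simp
  have sc := Real.sin_sq_add_cos_sq θ
  have sc' := Real.sin_sq_add_cos_sq θ'
  have a1 := h.inner_V
  have a2 := h.inner_P
  have a3 := h.inner_cos
  have a4 := h.inner_cos'
  have a5 := h.inner_cross
  have a6 := h.inner_cross'
  have b1 : ⟪v', v⟫ = 0 := by rw [real_inner_comm, a1]
  have b2 : ⟪w', w⟫ = 0 := by rw [real_inner_comm, a2]
  have b3 : ⟪w, v⟫ = Real.cos θ := by rw [real_inner_comm, a3]
  have b4 : ⟪w', v'⟫ = Real.cos θ' := by rw [real_inner_comm, a4]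
  have b5 : ⟪w', v⟫ = 0 := by rw [real_inner_comm, a5]
  have b6 : ⟪w, v'⟫ = 0 := by rw [real_inner_comm, a6]
  have n1 : ⟪v, v⟫ = 1 := by rw [real_inner_self_eq_norm_sq, h.norm, one_pow]
  have n2 : ⟪v', v'⟫ = 1 := by rw [real_inner_self_eq_norm_sq, h.norm', one_pow]
  have n3 : ⟪w, w⟫ = 1 := by rw [real_inner_self_eq_norm_sq, h.normP, one_pow]
  have n4 : ⟪w', w'⟫ = 1 := by rw [real_inner_self_eq_norm_sq, h.normP', one_pow]
  have orthV : ∀ n : Euc 4, ⟪v, n⟫ = 0 → ⟪v', n⟫ = 0 → n ∈ Vᗮ := fun n e e' ↦ by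
    rw [Submodule.mem_orthogonal]
    intro z hz
    rw [eq_add_of_mem_plane hV h.mem h.mem' h.norm h.norm' h.inner_V hz, inner_add_left,
      real_inner_smul_left, real_inner_smul_left, e, e', mul_zero, mul_zero, add_zero]
  have orthP : ∀ n : Euc 4, ⟪w, n⟫ = 0 → ⟪w', n⟫ = 0 → n ∈ Pᗮ := fun n e e' ↦ by
    rw [Submodule.mem_orthogonal]
    intro z hz
    rw [eq_add_of_mem_plane hP h.memP h.memP' h.normP h.normP' h.inner_P hz, inner_add_left,
      real_inner_smul_left, real_inner_smul_left, e, e', mul_zero, mul_zero, add_zero]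
  have norm_of : ∀ z : Euc 4, ⟪z, z⟫ = 1 → ‖z‖ = 1 := fun z hz ↦ by
    rw [norm_eq_sqrt_real_inner, hz, Real.sqrt_one]
  rw [eN, eN']
  refine ⟨hT.2.1, hT'.2.1, ?_, ?_, hT.1, hT'.1, ?_, ?_, ?_, ?_, ?_, ?_, ?_, ?_⟩
  · apply orthV <;>
      simp [inner_sub_right, real_inner_smul_right, h.norm, a3, b1, a6]
  · apply orthV <;>
      simp [inner_sub_right, real_inner_smul_right, h.norm', a1, a4, a5]
  · apply norm_of
    simp only [inner_sub_right, inner_sub_left, real_inner_smul_right, real_inner_smul_left, n1, n3,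
      a3, b3]
    field_simp
    rw [hε]
    linarith
  · apply norm_of
    simp only [inner_sub_right, inner_sub_left, real_inner_smul_right, real_inner_smul_left, n2, n4,
      a4, b4]
    field_simp
    rw [hδ]
    linarith
  · simp [real_inner_smul_right, real_inner_smul_left, a1]
  · simp [inner_sub_right, inner_sub_left, real_inner_smul_right, real_inner_smul_left, a1, a2, a5,
      b6]
  · have : Real.cos θ • ε • v - Real.sin θ • (ε * (Real.sin θ)⁻¹) • (Real.cos θ • v - w) =
        ε • w := by match_scalars <;> (field_simp; try ring)
    rw [this]
    exact P.smul_mem _ h.memP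
  · have : Real.cos θ' • δ • v' - Real.sin θ' • (δ * (Real.sin θ')⁻¹) • (Real.cos θ' • v' - w') =
        δ • w' := by match_scalars <;> (field_simp; try ring)
    rw [this]
    exact P.smul_mem _ h.memP'
  · apply orthP
    · simp only [inner_add_right, inner_sub_right, real_inner_smul_right, n3, b3]
      field_simp
      linear_combination ε * Real.cos θ * sc
    · simp [inner_add_right, inner_sub_right, real_inner_smul_right, b2, b5]
  · apply orthP
    · simp [inner_add_right, inner_sub_right, real_inner_smul_right, a2, b6]
    · simp only [inner_add_right, inner_sub_right, real_inner_smul_right, n4, b4]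
      field_simp
      linear_combination δ * Real.cos θ' * sc'

/-! ### Structure equations of an adapted frame -/

theorem two_le_infty : (2 : WithTop ℕ∞) ≤ ∞ := WithTop.coe_le_coe.mpr le_top

/-! ### Differentiating fields with constant inner products -/

section Calculus

variable {E F : Type*} [NormedAddCommGroup E] [NormedSpace ℝ E] [NormedAddCommGroup F]
  [InnerProductSpace ℝ F]

/-- The Leibniz rule for two vector fields whose inner product is constant. -/
theorem inner_fderiv_add_eq_zero {A B : E → F} {x : E} {c : ℝ} (hA : DifferentiableAt ℝ A x)
    (hB : DifferentiableAt ℝ B x) (h : ∀ᶠ y in 𝓝 x, ⟪A y, B y⟫ = c) (v : E) :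
    ⟪A x, fderiv ℝ B x v⟫ + ⟪fderiv ℝ A x v, B x⟫ = 0 := by
  rw [← fderiv_inner_apply ℝ hA hB, Filter.EventuallyEq.fderiv_eq (f := fun _ ↦ c) h]
  simp

theorem inner_fderiv_self_eq_zero {A : E → F} {x : E} {c : ℝ} (hA : DifferentiableAt ℝ A x)
    (h : ∀ᶠ y in 𝓝 x, ‖A y‖ = c) (v : E) : ⟪A x, fderiv ℝ A x v⟫ = 0 := by
  have := inner_fderiv_add_eq_zero (c := c ^ 2) hA hA
    (h.mono fun y hy ↦ by rw [real_inner_self_eq_norm_sq, hy]) v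
  rw [real_inner_comm (A x) (fderiv ℝ A x v)] at this
  rw [real_inner_comm] at this ⊢
  linarith

/-- Pair the field with constant vectors of `Wᗮ`, then use `Wᗮᗮ = W`. -/
theorem fderiv_mem_of_eventually_mem [FiniteDimensional ℝ F] {A : E → F} {x : E}
    (hA : DifferentiableAt ℝ A x)
    {W : Submodule ℝ F} (h : ∀ᶠ y in 𝓝 x, A y ∈ W) (v : E) : fderiv ℝ A x v ∈ W := by
  rw [← Submodule.orthogonal_orthogonal W, Submodule.mem_orthogonal]
  intro z hz
  have := inner_fderiv_add_eq_zero (c := 0) (differentiableAt_const z) hA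
    (h.mono fun y hy ↦ (W.mem_orthogonal' z).mp hz _ hy) v
  simpa using this

/-- An orthonormal frame of a fixed plane rotates. -/
theorem fderiv_planar_frame {w w' : E → Euc 4} {x : E} (hw : DifferentiableAt ℝ w x)
    (hw' : DifferentiableAt ℝ w' x) {W : Submodule ℝ (Euc 4)} (hW : Module.finrank ℝ W = 2)
    (h : ∀ᶠ y in 𝓝 x, (w y ∈ W ∧ w' y ∈ W) ∧ ‖w y‖ = 1 ∧ ‖w' y‖ = 1 ∧ ⟪w y, w' y⟫ = 0) (v : E) :
    fderiv ℝ w x v = ⟪w' x, fderiv ℝ w x v⟫ • w' x ∧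
      fderiv ℝ w' x v = -⟪w' x, fderiv ℝ w x v⟫ • w x := by
  obtain ⟨⟨m, m'⟩, n, n', o⟩ := h.self_of_nhds
  have e := eq_add_of_mem_plane hW m m' n n' o
    (fderiv_mem_of_eventually_mem hw (h.mono fun y hy ↦ hy.1.1) v)
  have e' := eq_add_of_mem_plane hW m m' n n' o
    (fderiv_mem_of_eventually_mem hw' (h.mono fun y hy ↦ hy.1.2) v)
  rw [inner_fderiv_self_eq_zero hw (h.mono fun y hy ↦ hy.2.1) v, zero_smul, zero_add] at e
  rw [inner_fderiv_self_eq_zero hw' (h.mono fun y hy ↦ hy.2.2.1) v, zero_smul, add_zero] at e'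
  refine ⟨e, ?_⟩
  have := inner_fderiv_add_eq_zero hw hw' (h.mono fun y hy ↦ hy.2.2.2) v
  rw [real_inner_comm (w' x)] at this
  rwa [eq_neg_of_add_eq_zero_left this] at e'

end Calculus

/-- The symmetry of the second fundamental form, in terms of a normal field. -/
theorem inner_fderiv_normal_symm {f N : Euc 2 → Euc 4} {x : Euc 2} (hf : ContDiffAt ℝ ∞ f x)
    (hN : DifferentiableAt ℝ N x) (h : ∀ᶠ y in 𝓝 x, ∀ u, ⟪fderiv ℝ f y u, N y⟫ = 0)
    (u v : Euc 2) : ⟪fderiv ℝ f x u, fderiv ℝ N x v⟫ = ⟪fderiv ℝ f x v, fderiv ℝ N x u⟫ := by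
  have hd : DifferentiableAt ℝ (fderiv ℝ f) x :=
    (hf.fderiv_right (m := 1) (by rw [one_add_one_eq_two]; exact two_le_infty)).differentiableAt (by simp)
  -- Differentiating `⟪df u, N⟫ = 0` along `v` expresses `⟪df u, dN v⟫` as `-⟪D²f(v, u), N⟫`, and
  -- `D²f` is symmetric.
  have key (u v : Euc 2) :
      ⟪fderiv ℝ f x u, fderiv ℝ N x v⟫ + ⟪fderiv ℝ (fderiv ℝ f) x v u, N x⟫ = 0 := by
    have := inner_fderiv_add_eq_zero (A := fun y ↦ fderiv ℝ f y u) (c := 0)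
      (hd.clm_apply (differentiableAt_const u)) hN (h.mono fun y hy ↦ hy u) v
    rwa [fderiv_clm_apply hd (differentiableAt_const u), add_apply,
      fderiv_fun_const, Pi.zero_apply, ContinuousLinearMap.comp_zero,
      zero_apply, zero_add, ContinuousLinearMap.flip_apply] at this
  have hs : IsSymmSndFDerivAt ℝ f x := hf.isSymmSndFDerivAt (by simpa using two_le_infty)
  have h1 := key u v
  have h2 := key v u
  rw [hs.eq] at h2
  linarith

theorem PointFrame.swap {V P : Submodule ℝ (Euc 4)} {θ θ' : ℝ} {T T' N N' : Euc 4}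
    (h : PointFrame V P θ θ' T T' N N') : PointFrame V P θ' θ T' T N' N where
  mem := h.mem'
  mem' := h.mem
  memN := h.memN'
  memN' := h.memN
  norm := h.norm'
  norm' := h.norm
  normN := h.normN'
  normN' := h.normN
  inner_T := by rw [real_inner_comm, h.inner_T]
  inner_N := by rw [real_inner_comm, h.inner_N]
  mem_P := h.mem_P'
  mem_P' := h.mem_P
  mem_orth := h.mem_orth'
  mem_orth' := h.mem_orth

namespace PointFrame

variable {V P : Submodule ℝ (Euc 4)} {θ θ' : ℝ} {T T' N N' : Euc 4}

theorem inner_T_N (h : PointFrame V P θ θ' T T' N N') : ⟪T, N⟫ = 0 :=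
  (V.mem_orthogonal N).mp h.memN _ h.mem

theorem inner_T_N' (h : PointFrame V P θ θ' T T' N N') : ⟪T, N'⟫ = 0 :=
  (V.mem_orthogonal N').mp h.memN' _ h.mem

theorem inner_T'_N (h : PointFrame V P θ θ' T T' N N') : ⟪T', N⟫ = 0 := h.swap.inner_T_N'

theorem inner_T'_N' (h : PointFrame V P θ θ' T T' N N') : ⟪T', N'⟫ = 0 := h.swap.inner_T_N

theorem inner_self (h : PointFrame V P θ θ' T T' N N') : ⟪T, T⟫ = 1 := by
  rw [real_inner_self_eq_norm_sq, h.norm, one_pow]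

theorem inner_self' (h : PointFrame V P θ θ' T T' N N') : ⟪T', T'⟫ = 1 := h.swap.inner_self

theorem inner_selfN (h : PointFrame V P θ θ' T T' N N') : ⟪N, N⟫ = 1 := by
  rw [real_inner_self_eq_norm_sq, h.normN, one_pow]

theorem inner_selfN' (h : PointFrame V P θ θ' T T' N N') : ⟪N', N'⟫ = 1 := h.swap.inner_selfN

theorem planar (h : PointFrame V P θ θ' T T' N N') :
    (Real.cos θ • T - Real.sin θ • N ∈ P ∧ Real.cos θ' • T' - Real.sin θ' • N' ∈ P) ∧
      ‖Real.cos θ • T - Real.sin θ • N‖ = 1 ∧ ‖Real.cos θ' • T' - Real.sin θ' • N'‖ = 1 ∧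
      ⟪Real.cos θ • T - Real.sin θ • N, Real.cos θ' • T' - Real.sin θ' • N'⟫ = 0 := by
  refine ⟨⟨h.mem_P, h.mem_P'⟩, ?_, ?_, ?_⟩
  · rw [norm_eq_sqrt_real_inner, Real.sqrt_eq_one]
    simp only [inner_sub_left, inner_sub_right, real_inner_smul_left, real_inner_smul_right,
      h.inner_self, h.inner_selfN, h.inner_T_N, real_inner_comm T N]
    linear_combination Real.sin_sq_add_cos_sq θ
  · rw [norm_eq_sqrt_real_inner, Real.sqrt_eq_one]
    simp only [inner_sub_left, inner_sub_right, real_inner_smul_left, real_inner_smul_right,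
      h.inner_self', h.inner_selfN', h.inner_T'_N', real_inner_comm T' N']
    linear_combination Real.sin_sq_add_cos_sq θ'
  · simp [inner_sub_left, inner_sub_right, real_inner_smul_left, real_inner_smul_right,
      h.inner_T, h.inner_N, h.inner_T_N', real_inner_comm T' N, h.inner_T'_N]

theorem planar_orth (h : PointFrame V P θ θ' T T' N N') :
    (Real.sin θ • T + Real.cos θ • N ∈ Pᗮ ∧ Real.sin θ' • T' + Real.cos θ' • N' ∈ Pᗮ) ∧
      ‖Real.sin θ • T + Real.cos θ • N‖ = 1 ∧ ‖Real.sin θ' • T' + Real.cos θ' • N'‖ = 1 ∧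
      ⟪Real.sin θ • T + Real.cos θ • N, Real.sin θ' • T' + Real.cos θ' • N'⟫ = 0 := by
  refine ⟨⟨h.mem_orth, h.mem_orth'⟩, ?_, ?_, ?_⟩
  · rw [norm_eq_sqrt_real_inner, Real.sqrt_eq_one]
    simp only [inner_add_left, inner_add_right, real_inner_smul_left, real_inner_smul_right,
      h.inner_self, h.inner_selfN, h.inner_T_N, real_inner_comm T N]
    linear_combination Real.sin_sq_add_cos_sq θ
  · rw [norm_eq_sqrt_real_inner, Real.sqrt_eq_one]
    simp only [inner_add_left, inner_add_right, real_inner_smul_left, real_inner_smul_right,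
      h.inner_self', h.inner_selfN', h.inner_T'_N', real_inner_comm T' N']
    linear_combination Real.sin_sq_add_cos_sq θ'
  · simp [inner_add_left, inner_add_right, real_inner_smul_left, real_inner_smul_right,
      h.inner_T, h.inner_N, h.inner_T_N', real_inner_comm T' N, h.inner_T'_N]

end PointFrame

/-- Inverting the rotation by `t` recovers the derivatives of `T` and `N` from those of the frames
of `P` and `Pᗮ`. -/
theorem eq_of_rotated {t : ℝ} {A B X Y : Euc 4} (h1 : Real.cos t • A - Real.sin t • B = X)
    (h2 : Real.sin t • A + Real.cos t • B = Y) :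
    A = Real.cos t • X + Real.sin t • Y ∧ B = Real.cos t • Y - Real.sin t • X := by
  have st := Real.sin_sq_add_cos_sq t
  subst h1 h2
  constructor
  · match_scalars
    · linear_combination -st
    · ring
  · match_scalars
    · linear_combination -st
    · ring

/-- `T, T', N, N'` is a smooth orthonormal frame along the immersion `f` of `U`, adapted to the
tangent planes and to their principal directions with respect to `P`. -/
structure AdaptedFrame (f : Euc 2 → Euc 4) (U : Set (Euc 2)) (P : Submodule ℝ (Euc 4)) (θ θ' : ℝ)
    (T T' N N' : Euc 2 → Euc 4) : Prop where
  isOpen : IsOpen U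
  contDiffOn : ContDiffOn ℝ ∞ f U
  contDiffOn_T : ContDiffOn ℝ ∞ T U
  contDiffOn_T' : ContDiffOn ℝ ∞ T' U
  contDiffOn_N : ContDiffOn ℝ ∞ N U
  contDiffOn_N' : ContDiffOn ℝ ∞ N' U
  injective : ∀ x ∈ U, Function.Injective (fderiv ℝ f x)
  frame : ∀ x ∈ U, PointFrame (LinearMap.range (fderiv ℝ f x : Euc 2 →ₗ[ℝ] Euc 4)) P θ θ'
    (T x) (T' x) (N x) (N' x)

/-- The structure equations of an adapted frame, with principal curvatures `l` and `m`. The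
connection forms of the tangent and normal bundles are linear combinations, with constant
coefficients, of the second fundamental forms. -/
structure StructureEqs (a b l m : ℝ) (T T' N N' : Euc 4)
    (df dT dT' dN dN' : Euc 2 →L[ℝ] Euc 4) : Prop where
  dT : ∀ v, dT v = -(a * (l * ⟪T, df v⟫) + b * (m * ⟪T', df v⟫)) • T' + (l * ⟪T, df v⟫) • N'
  dT' : ∀ v, dT' v = (a * (l * ⟪T, df v⟫) + b * (m * ⟪T', df v⟫)) • T + (m * ⟪T', df v⟫) • N
  dN : ∀ v, dN v = -(m * ⟪T', df v⟫) • T' - (b * (l * ⟪T, df v⟫) + a * (m * ⟪T', df v⟫)) • N'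
  dN' : ∀ v, dN' v = -(l * ⟪T, df v⟫) • T + (b * (l * ⟪T, df v⟫) + a * (m * ⟪T', df v⟫)) • N

/-- The discriminant `cos² θ sin² θ' - sin² θ cos² θ'` of a pair of angles. -/
def angleDisc (θ θ' : ℝ) : ℝ :=
  Real.cos θ ^ 2 * Real.sin θ' ^ 2 - Real.sin θ ^ 2 * Real.cos θ' ^ 2

/-- The coefficient of the tangential connection form along the second of two angles. -/
def angleCoeff (θ θ' : ℝ) : ℝ := Real.cos θ' * Real.sin θ' / angleDisc θ θ'

theorem angleDisc_swap (θ θ' : ℝ) : angleDisc θ' θ = -angleDisc θ θ' := by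
  unfold angleDisc; ring

theorem angleDisc_eq (θ θ' : ℝ) : angleDisc θ θ' = Real.cos θ ^ 2 - Real.cos θ' ^ 2 := by
  have h := Real.sin_sq_add_cos_sq θ
  have h' := Real.sin_sq_add_cos_sq θ'
  unfold angleDisc
  linear_combination Real.cos θ ^ 2 * h' - Real.cos θ' ^ 2 * h

/-- Exchanging the two directions exchanges `l` and `m` and reverses the sign of both connection
forms, whence `(a, b)` becomes `(-b, -a)`. For `a = angleCoeff θ θ'` and `b = -angleCoeff θ' θ` this
is the same pair with `θ, θ'` exchanged, so each argument about one direction also serves for the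
other. -/
theorem StructureEqs.swap {a b l m : ℝ} {T T' N N' : Euc 4} {df dT dT' dN dN' : Euc 2 →L[ℝ] Euc 4}
    (h : StructureEqs a b l m T T' N N' df dT dT' dN dN') :
    StructureEqs (-b) (-a) m l T' T N' N df dT' dT dN' dN where
  dT v := by rw [h.dT']; module
  dT' v := by rw [h.dT]; module
  dN v := by rw [h.dN']; module
  dN' v := by rw [h.dN]; module

namespace AdaptedFrame

variable {f : Euc 2 → Euc 4} {U : Set (Euc 2)} {P : Submodule ℝ (Euc 4)} {θ θ' : ℝ}
  {T T' N N' : Euc 2 → Euc 4}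

theorem swap (h : AdaptedFrame f U P θ θ' T T' N N') : AdaptedFrame f U P θ' θ T' T N' N where
  isOpen := h.isOpen
  contDiffOn := h.contDiffOn
  contDiffOn_T := h.contDiffOn_T'
  contDiffOn_T' := h.contDiffOn_T
  contDiffOn_N := h.contDiffOn_N'
  contDiffOn_N' := h.contDiffOn_N
  injective := h.injective
  frame x hx := (h.frame x hx).swap

theorem differentiableAt (h : AdaptedFrame f U P θ θ' T T' N N') {x : Euc 2} (hx : x ∈ U) :
    DifferentiableAt ℝ T x ∧ DifferentiableAt ℝ T' x ∧ DifferentiableAt ℝ N x ∧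
      DifferentiableAt ℝ N' x := by
  have hU := h.isOpen.mem_nhds hx
  exact ⟨(h.contDiffOn_T.contDiffAt hU).differentiableAt (by simp),
    (h.contDiffOn_T'.contDiffAt hU).differentiableAt (by simp),
    (h.contDiffOn_N.contDiffAt hU).differentiableAt (by simp),
    (h.contDiffOn_N'.contDiffAt hU).differentiableAt (by simp)⟩

theorem exists_preimage (h : AdaptedFrame f U P θ θ' T T' N N') {x : Euc 2} (hx : x ∈ U) :
    ∃ u, fderiv ℝ f x u = T x :=
  (h.frame x hx).mem

theorem finrank_range (h : AdaptedFrame f U P θ θ' T T' N N') {x : Euc 2} (hx : x ∈ U) :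
    Module.finrank ℝ (LinearMap.range (fderiv ℝ f x : Euc 2 →ₗ[ℝ] Euc 4)) = 2 := by
  rw [LinearMap.finrank_range_of_inj (h.injective x hx)]
  simp

theorem fderiv_eq (h : AdaptedFrame f U P θ θ' T T' N N') {x : Euc 2} (hx : x ∈ U) (v : Euc 2) :
    fderiv ℝ f x v = ⟪T x, fderiv ℝ f x v⟫ • T x + ⟪T' x, fderiv ℝ f x v⟫ • T' x :=
  eq_add_of_mem_plane (h.finrank_range hx) (h.frame x hx).mem (h.frame x hx).mem'
    (h.frame x hx).norm (h.frame x hx).norm' (h.frame x hx).inner_T ⟨v, rfl⟩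

/-- The derivatives of the frame, in terms of the rotations `α` and `β` of the associated frames
of `P` and of its orthogonal complement. -/
theorem exists_rotation (h : AdaptedFrame f U P θ θ' T T' N N') (hP : Module.finrank ℝ P = 2)
    {x : Euc 2} (hx : x ∈ U) (v : Euc 2) : ∃ α β : ℝ,
      fderiv ℝ T x v =
        (Real.cos θ * Real.cos θ' * α + Real.sin θ * Real.sin θ' * β) • T' x +
          (-(Real.cos θ * Real.sin θ' * α) + Real.sin θ * Real.cos θ' * β) • N' x ∧
      fderiv ℝ N x v =
        (-(Real.sin θ * Real.cos θ' * α) + Real.cos θ * Real.sin θ' * β) • T' x +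
          (Real.sin θ * Real.sin θ' * α + Real.cos θ * Real.cos θ' * β) • N' x ∧
      fderiv ℝ T' x v =
        -(Real.cos θ * Real.cos θ' * α + Real.sin θ * Real.sin θ' * β) • T x +
          (Real.cos θ' * Real.sin θ * α - Real.sin θ' * Real.cos θ * β) • N x ∧
      fderiv ℝ N' x v =
        (Real.sin θ' * Real.cos θ * α - Real.cos θ' * Real.sin θ * β) • T x -
          (Real.sin θ * Real.sin θ' * α + Real.cos θ * Real.cos θ' * β) • N x := by
  obtain ⟨dT, dT', dN, dN'⟩ := h.differentiableAt hx
  have hU : ∀ᶠ y in 𝓝 x, y ∈ U := h.isOpen.mem_nhds hx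
  have hPo : Module.finrank ℝ Pᗮ = 2 := by
    have := P.finrank_add_finrank_orthogonal
    rw [hP, finrank_euclideanSpace_fin] at this
    omega
  -- The pair `w, w'` is an orthonormal frame of `P` and `n, n'` one of `Pᗮ`. Each turns inside a
  -- fixed plane, by `α` and `β` respectively.
  let w := fun y ↦ Real.cos θ • T y - Real.sin θ • N y
  let w' := fun y ↦ Real.cos θ' • T' y - Real.sin θ' • N' y
  let n := fun y ↦ Real.sin θ • T y + Real.cos θ • N y
  let n' := fun y ↦ Real.sin θ' • T' y + Real.cos θ' • N' y
  have dw : HasFDerivAt w (Real.cos θ • fderiv ℝ T x - Real.sin θ • fderiv ℝ N x) x :=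
    (dT.hasFDerivAt.const_smul (Real.cos θ)).sub (dN.hasFDerivAt.const_smul (Real.sin θ))
  have dw' : HasFDerivAt w' (Real.cos θ' • fderiv ℝ T' x - Real.sin θ' • fderiv ℝ N' x) x :=
    (dT'.hasFDerivAt.const_smul (Real.cos θ')).sub (dN'.hasFDerivAt.const_smul (Real.sin θ'))
  have dn : HasFDerivAt n (Real.sin θ • fderiv ℝ T x + Real.cos θ • fderiv ℝ N x) x :=
    (dT.hasFDerivAt.const_smul (Real.sin θ)).add (dN.hasFDerivAt.const_smul (Real.cos θ))
  have dn' : HasFDerivAt n' (Real.sin θ' • fderiv ℝ T' x + Real.cos θ' • fderiv ℝ N' x) x :=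
    (dT'.hasFDerivAt.const_smul (Real.sin θ')).add (dN'.hasFDerivAt.const_smul (Real.cos θ'))
  obtain ⟨k, l⟩ := fderiv_planar_frame dw.differentiableAt dw'.differentiableAt hP
    (hU.mono fun y hy ↦ (h.frame y hy).planar) v
  obtain ⟨k', l'⟩ := fderiv_planar_frame dn.differentiableAt dn'.differentiableAt hPo
    (hU.mono fun y hy ↦ (h.frame y hy).planar_orth) v
  generalize ⟪w' x, fderiv ℝ w x v⟫ = α at k l
  generalize ⟪n' x, fderiv ℝ n x v⟫ = β at k' l'
  obtain ⟨e1, e2⟩ := eq_of_rotated ((DFunLike.congr_fun dw.fderiv v).symm.trans k)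
    ((DFunLike.congr_fun dn.fderiv v).symm.trans k')
  obtain ⟨e3, e4⟩ := eq_of_rotated ((DFunLike.congr_fun dw'.fderiv v).symm.trans l)
    ((DFunLike.congr_fun dn'.fderiv v).symm.trans l')
  refine ⟨α, β, e1.trans ?_, e2.trans ?_, e3.trans ?_, e4.trans ?_⟩
  · simp only [w', n']; module
  · simp only [w', n']; module
  · simp only [w, n]; module
  · simp only [w, n]; module

/-- The structure equations of an adapted frame. -/
theorem exists_structureEqs (h : AdaptedFrame f U P θ θ' T T' N N')
    (hP : Module.finrank ℝ P = 2) (hD : angleDisc θ θ' ≠ 0) {x : Euc 2} (hx : x ∈ U) :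
    ∃ l m : ℝ, StructureEqs (angleCoeff θ θ') (-angleCoeff θ' θ) l m (T x) (T' x) (N x) (N' x)
      (fderiv ℝ f x) (fderiv ℝ T x) (fderiv ℝ T' x) (fderiv ℝ N x) (fderiv ℝ N' x) := by
  have g := h.frame x hx
  obtain ⟨dT, dT', dN, dN'⟩ := h.differentiableAt hx
  have hU : ∀ᶠ y in 𝓝 x, y ∈ U := h.isOpen.mem_nhds hx
  have hf := h.contDiffOn.contDiffAt (h.isOpen.mem_nhds hx)
  obtain ⟨u, hu⟩ := h.exists_preimage hx
  obtain ⟨u', hu'⟩ := h.swap.exists_preimage hx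
  have orthN : ∀ᶠ y in 𝓝 x, ∀ v, ⟪fderiv ℝ f y v, N y⟫ = 0 := hU.mono fun y hy v ↦
    (Submodule.mem_orthogonal _ _).mp (h.frame y hy).memN _ ⟨v, rfl⟩
  have orthN' : ∀ᶠ y in 𝓝 x, ∀ v, ⟪fderiv ℝ f y v, N' y⟫ = 0 := hU.mono fun y hy v ↦
    (Submodule.mem_orthogonal _ _).mp (h.frame y hy).memN' _ ⟨v, rfl⟩
  have symN := inner_fderiv_normal_symm hf dN orthN u u'
  have symN' := inner_fderiv_normal_symm hf dN' orthN' u u'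
  choose α β hdT hdN hdT' hdN' using h.exists_rotation hP hx
  have A_eq (v) : ⟪N' x, fderiv ℝ T x v⟫ =
      -(Real.cos θ * Real.sin θ' * α v) + Real.sin θ * Real.cos θ' * β v := by
    rw [hdT]
    simp [inner_add_right, real_inner_smul_right, g.normN', real_inner_comm (T' x) (N' x),
      g.inner_T'_N']
  have B_eq (v) : ⟪N x, fderiv ℝ T' x v⟫ =
      Real.cos θ' * Real.sin θ * α v - Real.sin θ' * Real.cos θ * β v := by
    rw [hdT']
    simp [inner_add_right, real_inner_smul_right, g.normN, real_inner_comm (T x) (N x),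
      g.inner_T_N]
  -- The derivative of `N` has no component along `T`, so the symmetry of the second fundamental
  -- form in the direction `N` also removes the mixed entry. Only the `(T', T')` entry remains.
  have B_u : ⟪N x, fderiv ℝ T' x u⟫ = 0 := by
    rw [hu, hu', hdN, hdN] at symN
    simp only [inner_add_right, real_inner_smul_right, g.inner_T, g.inner_T_N', g.inner_self',
      g.inner_T'_N'] at symN
    rw [B_eq]
    linarith
  have A_u' : ⟪N' x, fderiv ℝ T x u'⟫ = 0 := by
    rw [hu, hu', hdN', hdN'] at symN'
    simp only [inner_sub_right, real_inner_smul_right, g.swap.inner_T, g.inner_T'_N, g.inner_self,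
      g.inner_T_N] at symN'
    rw [A_eq]
    linarith
  have decomp (v) : v = ⟪T x, fderiv ℝ f x v⟫ • u + ⟪T' x, fderiv ℝ f x v⟫ • u' := by
    apply h.injective x hx
    rw [map_add, map_smul, map_smul, hu, hu', ← h.fderiv_eq hx]
  refine ⟨⟪N' x, fderiv ℝ T x u⟫, ⟪N x, fderiv ℝ T' x u'⟫, ?_⟩
  have A_v (v) : ⟪N' x, fderiv ℝ T x u⟫ * ⟪T x, fderiv ℝ f x v⟫ =
      -(Real.cos θ * Real.sin θ' * α v) + Real.sin θ * Real.cos θ' * β v := by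
    rw [← A_eq v]
    conv_rhs => rw [decomp v, map_add, map_smul, map_smul, inner_add_right, real_inner_smul_right,
      real_inner_smul_right, A_u', mul_zero, add_zero, mul_comm]
  have B_v (v) : ⟪N x, fderiv ℝ T' x u'⟫ * ⟪T' x, fderiv ℝ f x v⟫ =
      Real.cos θ' * Real.sin θ * α v - Real.sin θ' * Real.cos θ * β v := by
    rw [← B_eq v]
    conv_rhs => rw [decomp v, map_add, map_smul, map_smul, inner_add_right, real_inner_smul_right,
      real_inner_smul_right, B_u, mul_zero, zero_add, mul_comm]
  have hD' : Real.sin θ' ^ 2 - Real.sin θ ^ 2 = angleDisc θ θ' := by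
    rw [Real.sin_sq, Real.sin_sq, angleDisc_eq]; ring
  have hD'' := angleDisc_eq θ θ'
  -- The two curvature forms are linear in `(α, β)` with determinant `angleDisc θ θ'`. Solving this
  -- system for `α, β` and substituting gives the coefficients of the tangential form here, and of
  -- the normal form in `norm`.
  have tang (v) : angleCoeff θ θ' * (-(Real.cos θ * Real.sin θ' * α v) +
      Real.sin θ * Real.cos θ' * β v) + -angleCoeff θ' θ * (Real.cos θ' * Real.sin θ * α v -
      Real.sin θ' * Real.cos θ * β v) =
      -(Real.cos θ * Real.cos θ' * α v + Real.sin θ * Real.sin θ' * β v) := by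
    rw [angleCoeff, angleCoeff, angleDisc_swap θ θ']
    field_simp
    linear_combination (-Real.cos θ * Real.cos θ' * α v) * hD' +
      (Real.sin θ * Real.sin θ' * β v) * hD''
  have norm (v) : -angleCoeff θ' θ * (-(Real.cos θ * Real.sin θ' * α v) +
      Real.sin θ * Real.cos θ' * β v) + angleCoeff θ θ' * (Real.cos θ' * Real.sin θ * α v -
      Real.sin θ' * Real.cos θ * β v) =
      -(Real.sin θ * Real.sin θ' * α v + Real.cos θ * Real.cos θ' * β v) := by
    rw [angleCoeff, angleCoeff, angleDisc_swap θ θ']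
    field_simp
    linear_combination (-Real.cos θ * Real.cos θ' * β v) * hD' +
      (Real.sin θ * Real.sin θ' * α v) * hD''
  constructor <;> intro v <;> rw [A_v, B_v]
  · rw [tang, hdT, neg_neg]
  · rw [tang, hdT']
  · rw [norm, hdN]; module
  · rw [norm, hdN']; module

end AdaptedFrame

/-! ### Isometric immersions of Euclidean domains and compositions -/

/-- The second derivative of a map, as a bilinear map. -/
abbrev secondFDeriv {m n : ℕ} (f : Euc m → Euc n) (x : Euc m) : Euc m →L[ℝ] Euc m →L[ℝ] Euc n :=
  fderiv ℝ (fderiv ℝ f) x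

theorem ContDiffAt.fderiv_infty {m : ℕ} {F : Type*} [NormedAddCommGroup F] [NormedSpace ℝ F]
    {f : Euc m → F} {x : Euc m} (hf : ContDiffAt ℝ ∞ f x) : ContDiffAt ℝ ∞ (fderiv ℝ f) x :=
  hf.fderiv_right (by simp)

theorem ContDiffAt.differentiableAt_infty {m : ℕ} {F : Type*} [NormedAddCommGroup F]
    [NormedSpace ℝ F] {f : Euc m → F} {x : Euc m} (hf : ContDiffAt ℝ ∞ f x) :
    DifferentiableAt ℝ f x :=
  hf.differentiableAt (by simp)

theorem ContDiffAt.fderiv_symm {m : ℕ} {F : Type*} [NormedAddCommGroup F] [NormedSpace ℝ F]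
    {f : Euc m → F} {x : Euc m} (hf : ContDiffAt ℝ ∞ f x) (u v : Euc m) :
    fderiv ℝ (fderiv ℝ f) x u v = fderiv ℝ (fderiv ℝ f) x v u :=
  (hf.isSymmSndFDerivAt (by simpa using two_le_infty)).eq u v

theorem fderiv_apply_const {m : ℕ} {G F : Type*} [NormedAddCommGroup F] [NormedSpace ℝ F]
    [NormedAddCommGroup G] [NormedSpace ℝ G] {A : Euc m → G →L[ℝ] F} {x : Euc m}
    (hA : DifferentiableAt ℝ A x) (c : G) (v : Euc m) :
    fderiv ℝ (fun y ↦ A y c) x v = fderiv ℝ A x v c := by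
  rw [fderiv_clm_apply hA (differentiableAt_const c)]
  simp

theorem eq_zero_or_eq_zero_of_finrank_eq_one {F : Type*} [NormedAddCommGroup F]
    [InnerProductSpace ℝ F] {W : Submodule ℝ F} (hW : Module.finrank ℝ W = 1) {z w : F}
    (hz : z ∈ W) (hw : w ∈ W) (h : ⟪z, w⟫ = 0) : z = 0 ∨ w = 0 := by
  by_contra! hne
  obtain ⟨c, hc⟩ := (finrank_eq_one_iff_of_nonzero' (⟨z, hz⟩ : W)
    (fun e ↦ hne.1 (congrArg Subtype.val e))).mp hW ⟨w, hw⟩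
  have hc' : c • z = w := congrArg Subtype.val hc
  rw [← hc', real_inner_smul_right, mul_eq_zero, inner_self_eq_zero] at h
  rcases h with rfl | h
  · exact hne.2 (by rw [← hc', zero_smul])
  · exact hne.1 h

namespace IsIsometricImmersionOn

variable {m n : ℕ} {f : Euc m → Euc n} {U : Set (Euc m)}

theorem contDiffAt (h : IsIsometricImmersionOn f U) {x : Euc m} (hx : x ∈ U) :
    ContDiffAt ℝ ∞ f x :=
  h.2.1.contDiffAt (h.1.mem_nhds hx)

/-- The second derivative of an isometric immersion is normal. -/
theorem inner_second (h : IsIsometricImmersionOn f U) {x : Euc m} (hx : x ∈ U) (u v w : Euc m) :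
    ⟪secondFDeriv f x u v, fderiv ℝ f x w⟫ = 0 := by
  have hf := h.contDiffAt hx
  have hd := hf.fderiv_infty.differentiableAt_infty
  have key (u v w : Euc m) : ⟪secondFDeriv f x u v, fderiv ℝ f x w⟫ +
      ⟪secondFDeriv f x u w, fderiv ℝ f x v⟫ = 0 := by
    have hU : ∀ᶠ y in 𝓝 x, y ∈ U := h.1.mem_nhds hx
    have := inner_fderiv_add_eq_zero (A := fun y ↦ fderiv ℝ f y v) (B := fun y ↦ fderiv ℝ f y w)
      (hd.clm_apply (differentiableAt_const v)) (hd.clm_apply (differentiableAt_const w))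
      (hU.mono fun y hy ↦ h.2.2 y hy v w) u
    rw [fderiv_apply_const hd, fderiv_apply_const hd,
      real_inner_comm (fderiv ℝ (fderiv ℝ f) x u w)] at this
    rw [add_comm]
    exact this
  -- A trilinear form symmetric in its first two arguments and skew in its last two is zero, as in
  -- the uniqueness of the Levi-Civita connection.
  have h1 := key u v w
  have h2 := key v w u
  have h3 := key w u v
  simp only [secondFDeriv] at *
  rw [hf.fderiv_symm v u] at h2
  rw [hf.fderiv_symm w u, hf.fderiv_symm w v] at h3
  linarith

theorem second_mem_orthogonal (h : IsIsometricImmersionOn f U) {x : Euc m} (hx : x ∈ U)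
    (u v : Euc m) :
    secondFDeriv f x u v ∈ (LinearMap.range (fderiv ℝ f x : Euc m →ₗ[ℝ] Euc n))ᗮ := by
  rw [Submodule.mem_orthogonal']
  rintro _ ⟨w, rfl⟩
  exact h.inner_second hx u v w

theorem injective_fderiv (h : IsIsometricImmersionOn f U) {x : Euc m} (hx : x ∈ U) :
    Function.Injective (fderiv ℝ f x) := by
  rw [injective_iff_map_eq_zero]
  intro u hu
  have := h.2.2 x hx u u
  rwa [hu, inner_zero_left, eq_comm, inner_self_eq_zero] at this

/-- The normal space of a Euclidean hypersurface is a line. -/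
theorem finrank_orthogonal {f : Euc m → Euc (m + 1)} (h : IsIsometricImmersionOn f U)
    {x : Euc m} (hx : x ∈ U) :
    Module.finrank ℝ (LinearMap.range (fderiv ℝ f x : Euc m →ₗ[ℝ] Euc (m + 1)))ᗮ = 1 := by
  have e := (LinearMap.range (fderiv ℝ f x : Euc m →ₗ[ℝ] Euc (m + 1))).finrank_add_finrank_orthogonal
  rw [LinearMap.finrank_range_of_inj (h.injective_fderiv hx), finrank_euclideanSpace_fin,
    finrank_euclideanSpace_fin] at e
  omega

/-- The Gauss equation of an isometric immersion of a Euclidean domain. -/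
theorem gauss (h : IsIsometricImmersionOn f U) {x : Euc m} (hx : x ∈ U) (u v w z : Euc m) :
    ⟪secondFDeriv f x u v, secondFDeriv f x w z⟫ =
      ⟪secondFDeriv f x u w, secondFDeriv f x v z⟫ := by
  have hf := h.contDiffAt hx
  have hd := hf.fderiv_infty.differentiableAt_infty
  have hdd := hf.fderiv_infty.fderiv_infty.differentiableAt_infty
  have hU : ∀ᶠ y in 𝓝 x, y ∈ U := h.1.mem_nhds hx
  -- Differentiating the normality of `D²f(u, v)` along `w` turns the left side into `-⟪D³f(w, u,
  -- v), df z⟫`, which is symmetric in `v` and `w`.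
  have key (v w : Euc m) : ⟪secondFDeriv f x u v, secondFDeriv f x w z⟫ +
      ⟪fderiv ℝ (fderiv ℝ (fderiv ℝ f)) x w u v, fderiv ℝ f x z⟫ = 0 := by
    have := inner_fderiv_add_eq_zero (A := fun y ↦ secondFDeriv f y u v)
      (B := fun y ↦ fderiv ℝ f y z)
      ((hdd.clm_apply (differentiableAt_const u)).clm_apply (differentiableAt_const v))
      (hd.clm_apply (differentiableAt_const z)) (hU.mono fun y hy ↦ h.inner_second hy u v z) w
    rwa [fderiv_apply_const hd, fderiv_apply_const (hdd.clm_apply (differentiableAt_const u)),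
      fderiv_apply_const hdd] at this
  have symm3 (w v : Euc m) : fderiv ℝ (fderiv ℝ (fderiv ℝ f)) x w u v =
      fderiv ℝ (fderiv ℝ (fderiv ℝ f)) x w v u := by
    have e : (fun y ↦ secondFDeriv f y u v) =ᶠ[𝓝 x] fun y ↦ secondFDeriv f y v u :=
      hU.mono fun y hy ↦ (h.contDiffAt hy).fderiv_symm u v
    have := DFunLike.congr_fun (e.fderiv_eq (𝕜 := ℝ)) w
    rwa [fderiv_apply_const (hdd.clm_apply (differentiableAt_const u)), fderiv_apply_const hdd,
      fderiv_apply_const (hdd.clm_apply (differentiableAt_const v)), fderiv_apply_const hdd] at this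
  have h1 := key v w
  have h2 := key w v
  rw [symm3, hf.fderiv_infty.fderiv_symm] at h1
  rw [symm3] at h2
  linarith

end IsIsometricImmersionOn

/-! ### Derivatives of a composition of isometric immersions -/

section Composition

variable {f : Euc 2 → Euc 4} {U : Set (Euc 2)} {g : Euc 2 → Euc 3} {W : Set (Euc 3)}
  {F : Euc 3 → Euc 4}

theorem fderiv_comp_on (hg : IsIsometricImmersionOn g U) (hF : IsIsometricImmersionOn F W)
    (hm : Set.MapsTo g U W) (he : Set.EqOn f (F ∘ g) U) {x : Euc 2} (hx : x ∈ U) :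
    fderiv ℝ f x = (fderiv ℝ F (g x)).comp (fderiv ℝ g x) := by
  have e : f =ᶠ[𝓝 x] F ∘ g := he.eventuallyEq_of_mem (hg.1.mem_nhds hx)
  rw [e.fderiv_eq]
  exact fderiv_comp x (hF.contDiffAt (hm hx)).differentiableAt_infty
    (hg.contDiffAt hx).differentiableAt_infty

theorem differentiableAt_fderiv_comp (hg : IsIsometricImmersionOn g U)
    (hF : IsIsometricImmersionOn F W) (hm : Set.MapsTo g U W) {x : Euc 2} (hx : x ∈ U) :
    HasFDerivAt (fun y ↦ fderiv ℝ F (g y)) ((secondFDeriv F (g x)).comp (fderiv ℝ g x)) x :=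
  (hF.contDiffAt (hm hx)).fderiv_infty.differentiableAt_infty.hasFDerivAt.comp x
    (hg.contDiffAt hx).differentiableAt_infty.hasFDerivAt

/-- The chain rule applied twice. For an isometric `F` the first summand is normal to `F` and the
second tangent to it, so the two are orthogonal. -/
theorem secondFDeriv_comp_on (hg : IsIsometricImmersionOn g U) (hF : IsIsometricImmersionOn F W)
    (hm : Set.MapsTo g U W) (he : Set.EqOn f (F ∘ g) U) {x : Euc 2} (hx : x ∈ U) (u v : Euc 2) :
    secondFDeriv f x u v = secondFDeriv F (g x) (fderiv ℝ g x u) (fderiv ℝ g x v) +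
      fderiv ℝ F (g x) (secondFDeriv g x u v) := by
  have hf : ContDiffAt ℝ ∞ f x :=
    ((hF.contDiffAt (hm hx)).comp x (hg.contDiffAt hx)).congr_of_eventuallyEq
      (he.eventuallyEq_of_mem (hg.1.mem_nhds hx))
  have e : (fun y ↦ fderiv ℝ f y v) =ᶠ[𝓝 x] fun y ↦ fderiv ℝ F (g y) (fderiv ℝ g y v) :=
    Filter.eventually_of_mem (hg.1.mem_nhds hx) fun y hy ↦ by
      simp only [fderiv_comp_on hg hF hm he hy, ContinuousLinearMap.comp_apply]
  have h1 := differentiableAt_fderiv_comp hg hF hm hx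
  have h2 := (hg.contDiffAt hx).fderiv_infty.differentiableAt_infty
  have h3 : DifferentiableAt ℝ (fun y ↦ fderiv ℝ g y v) x :=
    h2.clm_apply (differentiableAt_const v)
  rw [secondFDeriv, ← fderiv_apply_const hf.fderiv_infty.differentiableAt_infty,
    e.fderiv_eq (𝕜 := ℝ), fderiv_clm_apply h1.differentiableAt h3, h1.fderiv, add_comm, add_apply,
    ContinuousLinearMap.flip_apply, ContinuousLinearMap.comp_apply, ContinuousLinearMap.comp_apply,
    fderiv_apply_const h2]

end Composition

/-! ### Compositions have a vanishing principal curvature -/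

namespace AdaptedFrame

variable {f : Euc 2 → Euc 4} {U : Set (Euc 2)} {P : Submodule ℝ (Euc 4)} {θ θ' : ℝ}
  {T T' N N' : Euc 2 → Euc 4}

/-- Differentiating `⟪df v, N⟫ = 0` along `u` reduces the claim to the structure equation for `dN`,
of which only the `T'` component meets `df v`. -/
theorem inner_second_N (h : AdaptedFrame f U P θ θ' T T' N N') {x : Euc 2} (hx : x ∈ U)
    {a b l m : ℝ} (hs : StructureEqs a b l m (T x) (T' x) (N x) (N' x) (fderiv ℝ f x)
      (fderiv ℝ T x) (fderiv ℝ T' x) (fderiv ℝ N x) (fderiv ℝ N' x)) (u v : Euc 2) :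
    ⟪secondFDeriv f x u v, N x⟫ = m * ⟪T' x, fderiv ℝ f x u⟫ * ⟪T' x, fderiv ℝ f x v⟫ := by
  have hU : ∀ᶠ y in 𝓝 x, y ∈ U := h.isOpen.mem_nhds hx
  have hd := (h.contDiffOn.contDiffAt hU).fderiv_infty.differentiableAt_infty
  have := inner_fderiv_add_eq_zero (A := fun y ↦ fderiv ℝ f y v) (c := 0)
    (hd.clm_apply (differentiableAt_const v)) (h.differentiableAt hx).2.2.1
    (hU.mono fun y hy ↦ (Submodule.mem_orthogonal _ _).mp (h.frame y hy).memN _ ⟨v, rfl⟩) u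
  have o : ⟪fderiv ℝ f x v, N' x⟫ = 0 :=
    (Submodule.mem_orthogonal _ _).mp (h.frame x hx).memN' _ ⟨v, rfl⟩
  rw [fderiv_apply_const hd, hs.dN, inner_sub_right, real_inner_smul_right, real_inner_smul_right, o,
    real_inner_comm (T' x) (fderiv ℝ f x v)] at this
  rw [secondFDeriv]
  linarith

theorem inner_second_N' (h : AdaptedFrame f U P θ θ' T T' N N') {x : Euc 2} (hx : x ∈ U)
    {a b l m : ℝ} (hs : StructureEqs a b l m (T x) (T' x) (N x) (N' x) (fderiv ℝ f x)
      (fderiv ℝ T x) (fderiv ℝ T' x) (fderiv ℝ N x) (fderiv ℝ N' x)) (u v : Euc 2) :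
    ⟪secondFDeriv f x u v, N' x⟫ = l * ⟪T x, fderiv ℝ f x u⟫ * ⟪T x, fderiv ℝ f x v⟫ :=
  h.swap.inner_second_N hx hs.swap u v

theorem finrank_orthogonal (h : AdaptedFrame f U P θ θ' T T' N N') {x : Euc 2} (hx : x ∈ U) :
    Module.finrank ℝ (LinearMap.range (fderiv ℝ f x : Euc 2 →ₗ[ℝ] Euc 4))ᗮ = 2 := by
  have := (LinearMap.range (fderiv ℝ f x : Euc 2 →ₗ[ℝ] Euc 4)).finrank_add_finrank_orthogonal
  rw [h.finrank_range hx, finrank_euclideanSpace_fin] at this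
  omega

theorem secondFDeriv_eq (h : AdaptedFrame f U P θ θ' T T' N N') (hi : IsIsometricImmersionOn f U)
    {x : Euc 2} (hx : x ∈ U) {a b l m : ℝ} (hs : StructureEqs a b l m (T x) (T' x) (N x) (N' x)
      (fderiv ℝ f x) (fderiv ℝ T x) (fderiv ℝ T' x) (fderiv ℝ N x) (fderiv ℝ N' x)) (u v : Euc 2) :
    secondFDeriv f x u v = (m * ⟪T' x, fderiv ℝ f x u⟫ * ⟪T' x, fderiv ℝ f x v⟫) • N x +
      (l * ⟪T x, fderiv ℝ f x u⟫ * ⟪T x, fderiv ℝ f x v⟫) • N' x := by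
  have g := h.frame x hx
  rw [← h.inner_second_N hx hs, ← h.inner_second_N' hx hs, real_inner_comm, real_inner_comm (N' x)]
  exact eq_add_of_mem_plane (h.finrank_orthogonal hx) g.memN g.memN' g.normN g.normN' g.inner_N
    (hi.second_mem_orthogonal hx u v)

variable {g : Euc 2 → Euc 3} {W : Set (Euc 3)} {F : Euc 3 → Euc 4} {a b l m : ℝ}

/-- The normal curvature `l` of `g` and `m` of `F` cannot both be nonzero: the second derivatives
of `F` along `T'` and of `g` along `T` cannot both vanish. -/
theorem false_of_nullity (h : AdaptedFrame f U P θ θ' T T' N N') (hg : IsIsometricImmersionOn g U)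
    (hF : IsIsometricImmersionOn F W) (hm : Set.MapsTo g U W) (he : Set.EqOn f (F ∘ g) U)
    (hS : ∀ x ∈ U, ∃ l m, StructureEqs a b l m (T x) (T' x) (N x) (N' x) (fderiv ℝ f x)
      (fderiv ℝ T x) (fderiv ℝ T' x) (fderiv ℝ N x) (fderiv ℝ N' x))
    {x : Euc 2} (hx : x ∈ U) (hs : StructureEqs a b l m (T x) (T' x) (N x) (N' x) (fderiv ℝ f x)
      (fderiv ℝ T x) (fderiv ℝ T' x) (fderiv ℝ N x) (fderiv ℝ N' x))
    (ha : a ≠ 0) (hl : l ≠ 0) (hm0 : m ≠ 0) {u u' : Euc 2} (hu : fderiv ℝ f x u = T x)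
    (hu' : fderiv ℝ f x u' = T' x)
    (f22 : secondFDeriv f x u' u' = m • N x)
    (h11 : secondFDeriv F (g x) (fderiv ℝ g x u) (fderiv ℝ g x u) = l • N' x)
    (h12 : secondFDeriv F (g x) (fderiv ℝ g x u) (fderiv ℝ g x u') = 0)
    (h22 : secondFDeriv F (g x) (fderiv ℝ g x u') (fderiv ℝ g x u') = 0) : False := by
  have hU : ∀ᶠ y in 𝓝 x, y ∈ U := h.isOpen.mem_nhds hx
  have gx := h.frame x hx
  have hf := h.contDiffOn.contDiffAt hU
  obtain ⟨dT, dT', dN, dN'⟩ := h.differentiableAt hx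
  have df := hf.fderiv_infty.differentiableAt_infty
  have ddf := hf.fderiv_infty.fderiv_infty.differentiableAt_infty
  have dFg := differentiableAt_fderiv_comp hg hF hm hx
  have dg := (hg.contDiffAt hx).fderiv_infty.differentiableAt_infty
  have ddg := (hg.contDiffAt hx).fderiv_infty.fderiv_infty.differentiableAt_infty
  have ddFg : DifferentiableAt ℝ (fun y ↦ secondFDeriv F (g y)) x :=
    (hF.contDiffAt (hm hx)).fderiv_infty.fderiv_infty.differentiableAt_infty.comp x
      (hg.contDiffAt hx).differentiableAt_infty
  have dH (v w : Euc 2) : DifferentiableAt ℝ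
      (fun y ↦ secondFDeriv F (g y) (fderiv ℝ g y v) (fderiv ℝ g y w)) x :=
    (ddFg.clm_apply (dg.clm_apply (differentiableAt_const v))).clm_apply
      (dg.clm_apply (differentiableAt_const w))
  have dk : DifferentiableAt ℝ (fun y ↦ secondFDeriv g y u' u') x :=
    (ddg.clm_apply (differentiableAt_const u')).clm_apply (differentiableAt_const u')
  have dK : DifferentiableAt ℝ (fun y ↦ fderiv ℝ F (g y) (secondFDeriv g y u' u')) x :=
    dFg.differentiableAt.clm_apply dk
  have dff (v w : Euc 2) : DifferentiableAt ℝ (fun y ↦ secondFDeriv f y v w) x :=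
    (ddf.clm_apply (differentiableAt_const v)).clm_apply (differentiableAt_const w)
  have symF := (hF.contDiffAt (hm hx)).fderiv_symm
  -- `l N'` is a value of `D²F`, hence normal to `F`; and `l ≠ 0`.
  have N'F (z : Euc 3) : ⟪fderiv ℝ F (g x) z, N' x⟫ = 0 := by
    have := hF.inner_second (hm hx) (fderiv ℝ g x u) (fderiv ℝ g x u) z
    rw [h11, real_inner_smul_left, real_inner_comm] at this
    exact (mul_eq_zero.mp this).resolve_left hl
  -- the derivative of the part of `D²f (u', u')` coming from `g`
  have K' : ⟪fderiv ℝ (fun y ↦ fderiv ℝ F (g y) (secondFDeriv g y u' u')) x u', N' x⟫ = 0 := by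
    rw [fderiv_clm_apply dFg.differentiableAt dk, add_apply, ContinuousLinearMap.comp_apply,
      ContinuousLinearMap.flip_apply, dFg.fderiv, ContinuousLinearMap.comp_apply, inner_add_left,
      N'F, zero_add]
    -- Gauss for `F` moves one `u` next to `u'`, where `h12` makes the product vanish; the other
    -- factor `D²F(u, u) = l N'` then leaves the component along `N'`.
    have := hF.gauss (hm hx) (fderiv ℝ g x u') (secondFDeriv g x u' u') (fderiv ℝ g x u)
      (fderiv ℝ g x u)
    rw [secondFDeriv, symF (fderiv ℝ g x u') (fderiv ℝ g x u)] at this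
    rw [secondFDeriv] at h12 h11
    rw [h12, h11, inner_zero_left, real_inner_smul_right] at this
    exact (mul_eq_zero.mp this).resolve_left hl
  -- the derivative of the part coming from `F`
  have H' : ⟪fderiv ℝ (fun y ↦ secondFDeriv F (g y) (fderiv ℝ g y u') (fderiv ℝ g y u')) x u',
      N' x⟫ = 0 := by
    -- The Gauss equation holds near `x`, so it may be differentiated. At `x` the values `h12` and
    -- `h22` vanish, and only the derivative of the `(u', u')` term, paired with `l N'`, survives.
    have e : (fun y ↦ ⟪secondFDeriv F (g y) (fderiv ℝ g y u') (fderiv ℝ g y u'),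
        secondFDeriv F (g y) (fderiv ℝ g y u) (fderiv ℝ g y u)⟫) =ᶠ[𝓝 x]
        fun y ↦ ⟪secondFDeriv F (g y) (fderiv ℝ g y u) (fderiv ℝ g y u'),
          secondFDeriv F (g y) (fderiv ℝ g y u') (fderiv ℝ g y u)⟫ := hU.mono fun y hy ↦ by
      have := hF.gauss (hm hy) (fderiv ℝ g y u') (fderiv ℝ g y u') (fderiv ℝ g y u) (fderiv ℝ g y u)
      simp only
      rw [this, secondFDeriv, (hF.contDiffAt (hm hy)).fderiv_symm (fderiv ℝ g y u')]
    have e' := DFunLike.congr_fun (e.fderiv_eq (𝕜 := ℝ)) u'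
    rw [fderiv_inner_apply ℝ (dH _ _) (dH _ _), fderiv_inner_apply ℝ (dH _ _) (dH _ _), h22, h12,
      h11, inner_zero_left, inner_zero_left, zero_add, zero_add, secondFDeriv,
      symF (fderiv ℝ g x u') (fderiv ℝ g x u)] at e'
    rw [secondFDeriv] at h12
    rw [h12, inner_zero_right, real_inner_smul_right] at e'
    exact (mul_eq_zero.mp e').resolve_left hl
  -- the derivative of `⟪D²f (u', u'), N'⟫`, computed with the structure equations
  have s1 : fderiv ℝ (fun y ↦ ⟪secondFDeriv f y u' u', N' y⟫) x u' = a * m ^ 2 := by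
    have e : (fun y ↦ secondFDeriv f y u' u') =ᶠ[𝓝 x] fun y ↦
        secondFDeriv F (g y) (fderiv ℝ g y u') (fderiv ℝ g y u') +
          fderiv ℝ F (g y) (secondFDeriv g y u' u') :=
      hU.mono fun y hy ↦ secondFDeriv_comp_on hg hF hm he hy u' u'
    rw [fderiv_inner_apply ℝ (dff _ _) dN', e.fderiv_eq, fderiv_fun_add (dH _ _) dK, add_apply,
      inner_add_left, K', H', f22, hs.dN', hu', gx.inner_T, gx.inner_self']
    simp [real_inner_smul_right, real_inner_smul_left, gx.normN]
    ring
  -- Near `x` the function is `l ⟪T, df u'⟫²`, a square that vanishes at `x`. As `l` is only given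
  -- pointwise, with no differentiability, it is eliminated by comparing with the `(u, u)` entry.
  have s0 : fderiv ℝ (fun y ↦ ⟪secondFDeriv f y u' u', N' y⟫) x u' = 0 := by
    have e : (fun y ↦ ⟪secondFDeriv f y u' u', N' y⟫ * ⟪T y, fderiv ℝ f y u⟫ ^ 2) =ᶠ[𝓝 x]
        fun y ↦ ⟪secondFDeriv f y u u, N' y⟫ * ⟪T y, fderiv ℝ f y u'⟫ ^ 2 := hU.mono fun y hy ↦ by
      obtain ⟨l, m, hs⟩ := hS y hy
      simp only [h.inner_second_N' hy hs]
      ring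
    have dt (v : Euc 2) : DifferentiableAt ℝ (fun y ↦ ⟪T y, fderiv ℝ f y v⟫) x :=
      dT.inner ℝ (df.clm_apply (differentiableAt_const v))
    have dt2 (v : Euc 2) : DifferentiableAt ℝ (fun y ↦ ⟪T y, fderiv ℝ f y v⟫ ^ 2) x :=
      (dt v).fun_pow 2
    have e' := DFunLike.congr_fun (e.fderiv_eq (𝕜 := ℝ)) u'
    rw [fderiv_fun_mul ((dff _ _).inner ℝ dN') (dt2 _),
      fderiv_fun_mul ((dff _ _).inner ℝ dN') (dt2 _), fderiv_fun_pow 2 (dt u'), hu, hu',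
      gx.inner_self, gx.inner_T, f22, real_inner_smul_left, gx.inner_N] at e'
    simpa using e'
  rw [s0] at s1
  exact mul_ne_zero ha (pow_ne_zero 2 hm0) s1.symm

/-- A composition has at most one nonzero principal curvature. -/
theorem mul_eq_zero_of_composition (h : AdaptedFrame f U P θ θ' T T' N N')
    (hc : IsCompositionOn f U)
    (hS : ∀ x ∈ U, ∃ l m, StructureEqs a b l m (T x) (T' x) (N x) (N' x) (fderiv ℝ f x)
      (fderiv ℝ T x) (fderiv ℝ T' x) (fderiv ℝ N x) (fderiv ℝ N' x))
    {x : Euc 2} (hx : x ∈ U) (hs : StructureEqs a b l m (T x) (T' x) (N x) (N' x) (fderiv ℝ f x)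
      (fderiv ℝ T x) (fderiv ℝ T' x) (fderiv ℝ N x) (fderiv ℝ N' x))
    (ha : a ≠ 0) (hb : b ≠ 0) : l * m = 0 := by
  obtain ⟨hi, g, W, F, hg, hF, hm, he⟩ := hc
  by_contra hlm
  obtain ⟨hl, hm0⟩ := mul_ne_zero_iff.mp hlm
  have gx := h.frame x hx
  obtain ⟨u, hu⟩ := h.exists_preimage hx
  obtain ⟨u', hu'⟩ := h.swap.exists_preimage hx
  have split (v w : Euc 2) := secondFDeriv_comp_on hg hF hm he hx v w
  have f11 : secondFDeriv f x u u = l • N' x := by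
    rw [h.secondFDeriv_eq hi hx hs, hu, gx.inner_self, gx.swap.inner_T]
    simp
  have f12 : secondFDeriv f x u u' = 0 := by
    rw [h.secondFDeriv_eq hi hx hs, hu, hu', gx.inner_T, gx.swap.inner_T]
    simp
  have f22 : secondFDeriv f x u' u' = m • N x := by
    rw [h.secondFDeriv_eq hi hx hs, hu', gx.inner_self', gx.inner_T]
    simp
  -- The two summands of `D²f(u, u') = 0` are orthogonal, so each of them vanishes.
  have h12 : secondFDeriv F (g x) (fderiv ℝ g x u) (fderiv ℝ g x u') = 0 := by
    have e := split u u'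
    rw [f12] at e
    rw [← inner_self_eq_zero (𝕜 := ℝ)]
    nth_rw 2 [eq_neg_of_add_eq_zero_left e.symm]
    rw [inner_neg_right, hF.inner_second (hm hx), neg_zero]
  have k12 : secondFDeriv g x u u' = 0 := by
    have e := split u u'
    rw [f12, h12, zero_add] at e
    exact (map_eq_zero_iff _ (hF.injective_fderiv (hm hx))).mp e.symm
  -- With vanishing mixed entry, Gauss makes the two diagonal entries orthogonal; they lie in the
  -- normal line of a hypersurface, so one is zero. The same holds for `g` in `hK`.
  have hH := eq_zero_or_eq_zero_of_finrank_eq_one (hF.finrank_orthogonal (hm hx))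
    (hF.second_mem_orthogonal (hm hx) (fderiv ℝ g x u) (fderiv ℝ g x u))
    (hF.second_mem_orthogonal (hm hx) (fderiv ℝ g x u') (fderiv ℝ g x u'))
    (by rw [hF.gauss (hm hx), h12, inner_zero_left])
  have hK := eq_zero_or_eq_zero_of_finrank_eq_one (hg.finrank_orthogonal hx)
    (hg.second_mem_orthogonal hx u u) (hg.second_mem_orthogonal hx u' u')
    (by rw [hg.gauss hx, k12, inner_zero_left])
  have e11 := split u u
  have e22 := split u' u'
  rw [f11] at e11
  rw [f22] at e22
  -- If `F` and `g` are flat in the same direction, then `D²f` vanishes there, against `l, m ≠ 0`.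
  -- Otherwise one curvature comes from `F` and the other from `g`.
  rcases hH with hH | hH <;> rcases hK with hK | hK
  · rw [hH, hK, map_zero, add_zero, smul_eq_zero] at e11
    rcases e11 with e11 | e11
    · exact hl e11
    · simpa [e11] using gx.normN'
  · rw [hK, map_zero, add_zero] at e22
    refine h.swap.false_of_nullity hg hF hm he (fun y hy ↦ ?_) hx hs.swap (neg_ne_zero.mpr hb) hm0
      hl hu' hu f11 e22.symm ?_ hH
    · obtain ⟨l, m, hy⟩ := hS y hy
      exact ⟨m, l, hy.swap⟩
    · rw [secondFDeriv, (hF.contDiffAt (hm hx)).fderiv_symm]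
      exact h12
  · rw [hK, map_zero, add_zero] at e11
    exact h.false_of_nullity hg hF hm he hS hx hs ha hl hm0 hu hu' f22 e11.symm h12 hH
  · rw [hH, hK, map_zero, add_zero, smul_eq_zero] at e22
    rcases e22 with e22 | e22
    · exact hm0 e22
    · simpa [e22] using gx.normN

end AdaptedFrame

/-! ### Surfaces with a vanishing principal curvature are compositions -/

/-- The unit vector of the plane of argument `t`. -/
def rotVec (t : ℝ) : Euc 2 :=
  Real.cos t • EuclideanSpace.single 0 1 + Real.sin t • EuclideanSpace.single 1 1

/-- The unit vector of the plane of argument `t + π / 2`. -/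
def rotVecPerp (t : ℝ) : Euc 2 :=
  -Real.sin t • EuclideanSpace.single 0 1 + Real.cos t • EuclideanSpace.single 1 1

theorem hasDerivAt_rotVec (t : ℝ) : HasDerivAt rotVec (rotVecPerp t) t :=
  ((Real.hasDerivAt_cos t).smul_const _).add ((Real.hasDerivAt_sin t).smul_const _)

theorem hasDerivAt_rotVecPerp (t : ℝ) : HasDerivAt rotVecPerp (-rotVec t) t := by
  have := ((Real.hasDerivAt_sin t).neg.smul_const (EuclideanSpace.single (0 : Fin 2) (1 : ℝ))).add
    ((Real.hasDerivAt_cos t).smul_const (EuclideanSpace.single (1 : Fin 2) (1 : ℝ)))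
  convert! this using 1
  simp only [rotVec]
  module

theorem contDiff_rotVec : ContDiff ℝ ∞ rotVec :=
  (Real.contDiff_cos.smul contDiff_const).add (Real.contDiff_sin.smul contDiff_const)

theorem contDiff_rotVecPerp : ContDiff ℝ ∞ rotVecPerp :=
  (Real.contDiff_sin.neg.smul contDiff_const).add (Real.contDiff_cos.smul contDiff_const)

theorem inner_rotVec (t : ℝ) (y : Euc 2) :
    ⟪rotVec t, y⟫ = Real.cos t * y 0 + Real.sin t * y 1 := by
  simp [rotVec, inner_add_left, real_inner_smul_left, EuclideanSpace.inner_single_left]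

theorem inner_rotVecPerp (t : ℝ) (y : Euc 2) :
    ⟪rotVecPerp t, y⟫ = -Real.sin t * y 0 + Real.cos t * y 1 := by
  simp [rotVecPerp, inner_add_left, real_inner_smul_left, EuclideanSpace.inner_single_left]

theorem inner_rotVec_self (t : ℝ) : ⟪rotVec t, rotVec t⟫ = 1 := by
  rw [inner_rotVec]
  simp [rotVec, ← sq]

theorem inner_rotVecPerp_self (t : ℝ) : ⟪rotVecPerp t, rotVecPerp t⟫ = 1 := by
  rw [inner_rotVecPerp]
  simp [rotVecPerp, ← sq]

theorem inner_rotVec_perp (t : ℝ) : ⟪rotVec t, rotVecPerp t⟫ = 0 := by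
  rw [inner_rotVec]
  simp [rotVecPerp]
  ring

/-- The splitting of `ℝ³` as the product of a plane and a line. -/
def eucThreeSplit : Euc 3 ≃L[ℝ] Euc 2 × ℝ :=
  LinearEquiv.toContinuousLinearEquiv
    { toFun := fun y ↦ (!₂[y 0, y 1], y 2)
      invFun := fun w ↦ !₂[w.1 0, w.1 1, w.2]
      map_add' := fun y z ↦ by
        ext j
        · fin_cases j <;> simp
        · simp
      map_smul' := fun c y ↦ by
        ext j
        · fin_cases j <;> simp
        · simp
      left_inv := fun y ↦ by
        ext j
        fin_cases j <;> simp
      right_inv := fun w ↦ by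
        ext j
        · fin_cases j <;> simp
        · simp }

theorem inner_eucThreeSplit (y z : Euc 3) : ⟪y, z⟫ =
    ⟪(eucThreeSplit y).1, (eucThreeSplit z).1⟫ + (eucThreeSplit y).2 * (eucThreeSplit z).2 := by
  simp only [eucThreeSplit, PiLp.inner_apply, Fin.sum_univ_two, Fin.sum_univ_three,
    RCLike.inner_apply, conj_trivial]
  simp [mul_comm]

theorem IsIsometricImmersionOn.comp {l m n : ℕ} {g : Euc l → Euc m} {F : Euc m → Euc n}
    {U : Set (Euc l)} {W : Set (Euc m)} (hg : IsIsometricImmersionOn g U)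
    (hF : IsIsometricImmersionOn F W) (hm : Set.MapsTo g U W) :
    IsIsometricImmersionOn (F ∘ g) U := by
  refine ⟨hg.1, hF.2.1.comp hg.2.1 hm, fun x hx u v ↦ ?_⟩
  rw [fderiv_comp x (hF.contDiffAt (hm hx)).differentiableAt_infty
    (hg.contDiffAt hx).differentiableAt_infty, ContinuousLinearMap.comp_apply,
    ContinuousLinearMap.comp_apply, hF.2.2 _ (hm hx), hg.2.2 x hx]

theorem IsIsometricImmersionOn.congr {m n : ℕ} {f g : Euc m → Euc n} {U : Set (Euc m)}
    (hg : IsIsometricImmersionOn g U) (h : Set.EqOn f g U) : IsIsometricImmersionOn f U := by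
  refine ⟨hg.1, hg.2.1.congr h, fun x hx u v ↦ ?_⟩
  rw [(h.eventuallyEq_of_mem (hg.1.mem_nhds hx)).fderiv_eq, hg.2.2 x hx]

/-- A primitive of a smooth closed form on an open convex set is smooth. -/
theorem exists_contDiffOn_primitive {F : Type*} [NormedAddCommGroup F] [NormedSpace ℝ F]
    [CompleteSpace F]
    {B : Set (Euc 2)} (hB : Convex ℝ B) (hBo : IsOpen B)
    {η : Euc 2 → Euc 2 →L[ℝ] F} (hη : ContDiffOn ℝ ∞ η B)
    (hc : ∀ x ∈ B, ∀ u v, fderiv ℝ η x u v = fderiv ℝ η x v u) :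
    ∃ τ : Euc 2 → F, ContDiffOn ℝ ∞ τ B ∧ ∀ x ∈ B, HasFDerivAt τ (η x) x := by
  obtain ⟨τ, hτ⟩ := hB.exists_forall_hasFDerivAt_of_fderiv_symmetric hBo
    (hη.differentiableOn (by simp)) hc
  refine ⟨τ, ?_, hτ⟩
  rw [contDiffOn_infty_iff_fderiv_of_isOpen hBo]
  exact ⟨fun x hx ↦ (hτ x hx).differentiableAt.differentiableWithinAt,
    hη.congr fun x hx ↦ (hτ x hx).fderiv⟩

/-- An extension `Ft` of an immersion `f = Ft (·, 0)` to a thickening of its domain, having the same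
induced metric as a map `G` into the Euclidean space `ℝ² × ℝ`, shows that `f` is a composition
up to a change of parameters. -/
theorem exists_isCompositionOn_of_thickening {f : Euc 2 → Euc 4} {B : Set (Euc 2)} (hB : IsOpen B)
    {G : Euc 2 × ℝ → Euc 2 × ℝ} {Ft : Euc 2 × ℝ → Euc 4} (hG : ContDiffOn ℝ ∞ G (B ×ˢ Set.univ))
    (hFt : ContDiffOn ℝ ∞ Ft (B ×ˢ Set.univ)) (hG2 : ∀ w, (G w).2 = w.2)
    (hFt0 : ∀ x, Ft (x, 0) = f x)
    (hinj : ∀ w ∈ B ×ˢ (Set.univ : Set ℝ), Function.Injective (fderiv ℝ G w))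
    (hmet : ∀ w ∈ B ×ˢ (Set.univ : Set ℝ), ∀ u v, ⟪fderiv ℝ Ft w u, fderiv ℝ Ft w v⟫ =
      ⟪(fderiv ℝ G w u).1, (fderiv ℝ G w v).1⟫ + (fderiv ℝ G w u).2 * (fderiv ℝ G w v).2)
    {x₀ : Euc 2} (hx₀ : x₀ ∈ B) :
    ∃ (O : Set (Euc 2)) (ψ : Euc 2 → Euc 2), IsOpen O ∧ ContDiffOn ℝ ∞ ψ O ∧ Set.MapsTo ψ O B ∧
      x₀ ∈ ψ '' O ∧ IsCompositionOn (f ∘ ψ) O := by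
  have hBo : IsOpen (B ×ˢ (Set.univ : Set ℝ)) := hB.prod isOpen_univ
  have hw₀ : (x₀, (0 : ℝ)) ∈ B ×ˢ (Set.univ : Set ℝ) := ⟨hx₀, trivial⟩
  have hGat (w) (hw : w ∈ B ×ˢ (Set.univ : Set ℝ)) : ContDiffAt ℝ ∞ G w :=
    hG.contDiffAt (hBo.mem_nhds hw)
  have hequiv (w) (hw : w ∈ B ×ˢ (Set.univ : Set ℝ)) :
      ∃ e : (Euc 2 × ℝ) ≃L[ℝ] Euc 2 × ℝ, HasFDerivAt G (e : (Euc 2 × ℝ) →L[ℝ] Euc 2 × ℝ) w := by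
    refine ⟨(LinearEquiv.ofInjectiveEndo (fderiv ℝ G w : (Euc 2 × ℝ) →ₗ[ℝ] Euc 2 × ℝ)
      (hinj w hw)).toContinuousLinearEquiv, ?_⟩
    have : ((LinearEquiv.ofInjectiveEndo (fderiv ℝ G w : (Euc 2 × ℝ) →ₗ[ℝ] Euc 2 × ℝ)
      (hinj w hw)).toContinuousLinearEquiv : (Euc 2 × ℝ) →L[ℝ] Euc 2 × ℝ) = fderiv ℝ G w := by
      ext <;> rfl
    rw [this]
    exact ((hGat w hw).differentiableAt (by simp)).hasFDerivAt
  obtain ⟨e₀, he₀⟩ := hequiv _ hw₀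
  -- Inverse function theorem: `F` will be `Ft` read in the flat coordinates given by `G`, and `g`
  -- the inclusion of the plane `t = 0`.
  let K := (hGat _ hw₀).toOpenPartialHomeomorph G he₀ (by simp)
  have hK : ∀ w, K w = G w := fun w ↦ rfl
  have hKs : (x₀, (0 : ℝ)) ∈ K.source :=
    (hGat _ hw₀).mem_toOpenPartialHomeomorph_source he₀ (by simp)
  let W' : Set (Euc 2 × ℝ) := K.target ∩ K.symm ⁻¹' (B ×ˢ Set.univ)
  have hW' : IsOpen W' := K.symm.isOpen_inter_preimage hBo
  have hsymm (y) (hy : y ∈ W') : ContDiffAt ℝ ∞ K.symm y := by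
    obtain ⟨e, he⟩ := hequiv _ hy.2
    exact K.contDiffAt_symm hy.1 he (hGat _ hy.2)
  -- The inverse preserves the height, so the plane at height `0` corresponds to the surface itself.
  have hK2 (y) (hy : y ∈ W') : (K.symm y).2 = y.2 := by
    rw [← hG2, ← hK, K.right_inv hy.1]
  have hmet' (y) (hy : y ∈ W') (u v : Euc 2 × ℝ) :
      ⟪fderiv ℝ (Ft ∘ K.symm) y u, fderiv ℝ (Ft ∘ K.symm) y v⟫ = ⟪u.1, v.1⟫ + u.2 * v.2 := by
    obtain ⟨e, he⟩ := hequiv _ hy.2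
    have h1 := K.hasFDerivAt_symm hy.1 he
    have h2 := ((hFt.contDiffAt (hBo.mem_nhds hy.2)).differentiableAt (by simp)).hasFDerivAt.comp y h1
    rw [h2.fderiv, ContinuousLinearMap.comp_apply, ContinuousLinearMap.comp_apply, hmet _ hy.2,
      he.fderiv]
    simp
  let ι : Euc 2 →L[ℝ] Euc 3 :=
    (eucThreeSplit.symm : (Euc 2 × ℝ) →L[ℝ] Euc 3).comp (ContinuousLinearMap.inl ℝ (Euc 2) ℝ)
  have hι (x) : eucThreeSplit (ι x) = (x, 0) := eucThreeSplit.apply_symm_apply _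
  let W : Set (Euc 3) := eucThreeSplit ⁻¹' W'
  have hW : IsOpen W := hW'.preimage eucThreeSplit.continuous
  let F : Euc 3 → Euc 4 := (Ft ∘ K.symm) ∘ eucThreeSplit
  have hFsm (y) (hy : y ∈ W') : ContDiffAt ℝ ∞ (Ft ∘ K.symm) y :=
    (hFt.contDiffAt (hBo.mem_nhds hy.2)).comp y (hsymm y hy)
  have hF : IsIsometricImmersionOn F W := by
    refine ⟨hW, fun y hy ↦ ((hFsm _ hy).comp y
      eucThreeSplit.contDiff.contDiffAt).contDiffWithinAt, fun y hy u v ↦ ?_⟩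
    rw [fderiv_comp y ((hFsm _ hy).differentiableAt (by simp)) eucThreeSplit.differentiableAt,
      eucThreeSplit.fderiv, ContinuousLinearMap.comp_apply, ContinuousLinearMap.comp_apply,
      hmet' _ hy, inner_eucThreeSplit]
    rfl
  have hO : IsOpen (ι ⁻¹' W) := hW.preimage ι.continuous
  have hg : IsIsometricImmersionOn ι (ι ⁻¹' W) := by
    refine ⟨hO, ι.contDiff.contDiffOn, fun x _ u v ↦ ?_⟩
    rw [ι.fderiv, inner_eucThreeSplit, hι, hι]
    simp
  have hmaps : Set.MapsTo ι (ι ⁻¹' W) W := fun x hx ↦ hx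
  have hmem (x) (hx : x ∈ ι ⁻¹' W) : ((x, 0) : Euc 2 × ℝ) ∈ W' := by
    have : eucThreeSplit (ι x) ∈ W' := hx
    rwa [hι] at this
  have heq : Set.EqOn (f ∘ fun x ↦ (K.symm (x, 0)).1) (F ∘ ι) (ι ⁻¹' W) := fun x hx ↦ by
    have e : ((K.symm (x, 0)).1, (0 : ℝ)) = K.symm (x, 0) :=
      Prod.ext rfl (hK2 _ (hmem x hx)).symm
    simp only [F, Function.comp_apply]
    rw [hι, ← hFt0, e]
  refine ⟨ι ⁻¹' W, fun x ↦ (K.symm (x, 0)).1, hO, fun x hx ↦ ?_, fun x hx ↦ (hmem x hx).2.1,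
    ⟨(G (x₀, 0)).1, ?_, ?_⟩, (hg.comp hF hmaps).congr heq, ι, W, F, hg, hF, hmaps, heq⟩
  · have : ContDiffAt ℝ ∞ (fun x : Euc 2 ↦ ((x, 0) : Euc 2 × ℝ)) x :=
      contDiffAt_id.prodMk contDiffAt_const
    exact (((hsymm _ (hmem x hx)).comp x this).fst).contDiffWithinAt
  · have e : (((G (x₀, 0)).1, 0) : Euc 2 × ℝ) = K (x₀, 0) := Prod.ext rfl (hG2 (x₀, 0)).symm
    have : eucThreeSplit (ι (G (x₀, 0)).1) ∈ W' := by
      rw [hι, e]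
      refine ⟨K.map_source hKs, ?_⟩
      rw [Set.mem_preimage, K.left_inv hKs]
      exact hw₀
    exact this
  · have e : (((G (x₀, 0)).1, 0) : Euc 2 × ℝ) = K (x₀, 0) := Prod.ext rfl (hG2 (x₀, 0)).symm
    simp only [e, K.left_inv hKs]

namespace AdaptedFrame

variable {f : Euc 2 → Euc 4} {U : Set (Euc 2)} {P : Submodule ℝ (Euc 4)} {θ θ' : ℝ}
  {T T' N N' : Euc 2 → Euc 4} {a b : ℝ}

/-- The connection form of an adapted frame. -/
def connForm (T T' : Euc 2 → Euc 4) (x : Euc 2) : Euc 2 →L[ℝ] ℝ :=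
  (innerSL ℝ (T x)).comp (fderiv ℝ T' x)

theorem mono {V : Set (Euc 2)} (h : AdaptedFrame f U P θ θ' T T' N N') (hV : IsOpen V)
    (hVU : V ⊆ U) : AdaptedFrame f V P θ θ' T T' N N' where
  isOpen := hV
  contDiffOn := h.contDiffOn.mono hVU
  contDiffOn_T := h.contDiffOn_T.mono hVU
  contDiffOn_T' := h.contDiffOn_T'.mono hVU
  contDiffOn_N := h.contDiffOn_N.mono hVU
  contDiffOn_N' := h.contDiffOn_N'.mono hVU
  injective x hx := h.injective x (hVU hx)
  frame x hx := h.frame x (hVU hx)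

theorem contDiffOn_connForm (h : AdaptedFrame f U P θ θ' T T' N N') :
    ContDiffOn ℝ ∞ (connForm T T') U :=
  ((innerSL ℝ).contDiff.comp_contDiffOn h.contDiffOn_T).clm_comp
    (h.contDiffOn_T'.fderiv_of_isOpen h.isOpen (by simp))

/-- The first summand is symmetric in `u, v`, so closedness of the connection form depends on the
second alone. -/
theorem fderiv_connForm (h : AdaptedFrame f U P θ θ' T T' N N') {x : Euc 2} (hx : x ∈ U)
    (u v : Euc 2) : fderiv ℝ (connForm T T') x u v =
      ⟪T x, fderiv ℝ (fderiv ℝ T') x u v⟫ + ⟪fderiv ℝ T x u, fderiv ℝ T' x v⟫ := by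
  have d := (h.contDiffOn_connForm.contDiffAt (h.isOpen.mem_nhds hx)).differentiableAt_infty
  have d' := (h.contDiffOn_T'.contDiffAt (h.isOpen.mem_nhds hx)).fderiv_infty.differentiableAt_infty
  rw [← fderiv_apply_const d]
  have : (fun y ↦ connForm T T' y v) = fun y ↦ ⟪T y, fderiv ℝ T' y v⟫ := rfl
  rw [this, fderiv_inner_apply ℝ (h.differentiableAt hx).1 (d'.clm_apply (differentiableAt_const v)),
    fderiv_apply_const d']


/-- The derivatives of an adapted frame whose first principal curvature vanishes. -/
theorem exists_ruled (h : AdaptedFrame f U P θ θ' T T' N N') {x : Euc 2} (hx : x ∈ U) {m : ℝ}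
    (hs : StructureEqs a b 0 m (T x) (T' x) (N x) (N' x) (fderiv ℝ f x)
      (fderiv ℝ T x) (fderiv ℝ T' x) (fderiv ℝ N x) (fderiv ℝ N' x)) (v : Euc 2) :
    connForm T T' x v = b * (m * ⟪T' x, fderiv ℝ f x v⟫) ∧
    fderiv ℝ T x v = -connForm T T' x v • T' x ∧
    fderiv ℝ T' x v = connForm T T' x v • T x + (m * ⟪T' x, fderiv ℝ f x v⟫) • N x ∧
    fderiv ℝ N' x v = (a * (m * ⟪T' x, fderiv ℝ f x v⟫)) • N x := by
  have g := h.frame x hx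
  have e : connForm T T' x v = b * (m * ⟪T' x, fderiv ℝ f x v⟫) := by
    change ⟪T x, fderiv ℝ T' x v⟫ = _
    rw [hs.dT']
    simp [inner_add_right, real_inner_smul_right, g.norm, g.inner_T_N]
  refine ⟨e, ?_, ?_, ?_⟩
  · rw [hs.dT, e]; simp
  · rw [hs.dT', e]; simp
  · rw [hs.dN']; simp

/-- The form `q θ + q' θ'` with values in the plane, where `θ, θ'` is the dual coframe. -/
def coframeForm (f T T' : Euc 2 → Euc 4) (q q' : Euc 2 → Euc 2) (x : Euc 2) : Euc 2 →L[ℝ] Euc 2 :=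
  ((innerSL ℝ (T x)).comp (fderiv ℝ f x)).smulRight (q x) +
    ((innerSL ℝ (T' x)).comp (fderiv ℝ f x)).smulRight (q' x)

theorem coframeForm_apply (f T T' : Euc 2 → Euc 4) (q q' : Euc 2 → Euc 2) (x v : Euc 2) :
    coframeForm f T T' q q' x v = ⟪T x, fderiv ℝ f x v⟫ • q x + ⟪T' x, fderiv ℝ f x v⟫ • q' x :=
  rfl

theorem contDiffOn_coframeForm (h : AdaptedFrame f U P θ θ' T T' N N') {q q' : Euc 2 → Euc 2}
    (hq : ContDiffOn ℝ ∞ q U) (hq' : ContDiffOn ℝ ∞ q' U) :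
    ContDiffOn ℝ ∞ (coframeForm f T T' q q') U := by
  have df : ContDiffOn ℝ ∞ (fderiv ℝ f) U := h.contDiffOn.fderiv_of_isOpen h.isOpen (by simp)
  exact ((((innerSL ℝ).contDiff.comp_contDiffOn h.contDiffOn_T).clm_comp df).smulRight hq).add
    ((((innerSL ℝ).contDiff.comp_contDiffOn h.contDiffOn_T').clm_comp df).smulRight hq')

/-- If `q, q'` rotates in the plane as `T, T'` does in the tangent planes, then the coframe form is
closed. -/
theorem fderiv_coframeForm_symm (h : AdaptedFrame f U P θ θ' T T' N N')
    (hS : ∀ x ∈ U, ∃ m, StructureEqs a b 0 m (T x) (T' x) (N x) (N' x) (fderiv ℝ f x)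
      (fderiv ℝ T x) (fderiv ℝ T' x) (fderiv ℝ N x) (fderiv ℝ N' x))
    {q q' : Euc 2 → Euc 2} (hq : ContDiffOn ℝ ∞ q U) (hq' : ContDiffOn ℝ ∞ q' U)
    (dq : ∀ x ∈ U, ∀ v, fderiv ℝ q x v = -connForm T T' x v • q' x)
    (dq' : ∀ x ∈ U, ∀ v, fderiv ℝ q' x v = connForm T T' x v • q x)
    {x : Euc 2} (hx : x ∈ U) (u v : Euc 2) :
    fderiv ℝ (coframeForm f T T' q q') x u v = fderiv ℝ (coframeForm f T T' q q') x v u := by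
  have g := h.frame x hx
  have hU := h.isOpen.mem_nhds hx
  obtain ⟨m, hs⟩ := hS x hx
  have d := ((h.contDiffOn_coframeForm hq hq').contDiffAt hU).differentiableAt_infty
  have df := (h.contDiffOn.contDiffAt hU).fderiv_infty.differentiableAt_infty
  have dqx := (hq.contDiffAt hU).differentiableAt_infty
  have dqx' := (hq'.contDiffAt hU).differentiableAt_infty
  obtain ⟨dT, dT', -, -⟩ := h.differentiableAt hx
  -- The rotation of `q, q'` cancels that of `T, T'` in the Leibniz rule, and the `N` part of `dT'`
  -- is orthogonal to `df v`. Only the symmetric terms in `D²f` remain.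
  have key (u v : Euc 2) : fderiv ℝ (coframeForm f T T' q q') x u v =
      ⟪T x, fderiv ℝ (fderiv ℝ f) x u v⟫ • q x + ⟪T' x, fderiv ℝ (fderiv ℝ f) x u v⟫ • q' x := by
    have e : (fun y ↦ coframeForm f T T' q q' y v) =
      fun y ↦ ⟪T y, fderiv ℝ f y v⟫ • q y + ⟪T' y, fderiv ℝ f y v⟫ • q' y := rfl
    have dfv := df.clm_apply (differentiableAt_const v)
    have i1 := dT.inner ℝ dfv
    have i2 := dT'.inner ℝ dfv
    have oN : ⟪N x, fderiv ℝ f x v⟫ = 0 :=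
      (Submodule.mem_orthogonal' _ _).mp g.memN _ ⟨v, rfl⟩
    obtain ⟨-, eT, eT', -⟩ := h.exists_ruled hx hs u
    rw [← fderiv_apply_const d, e, fderiv_fun_add (i1.fun_smul dqx) (i2.fun_smul dqx'),
      fderiv_fun_smul i1 dqx, fderiv_fun_smul i2 dqx']
    simp only [add_apply, smul_apply, ContinuousLinearMap.smulRight_apply]
    rw [fderiv_inner_apply ℝ dT dfv, fderiv_inner_apply ℝ dT' dfv, fderiv_apply_const df, dq x hx,
      dq' x hx, eT, eT']
    simp only [inner_add_left, real_inner_smul_left, oN]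
    module
  have sym := (h.contDiffOn.contDiffAt hU).fderiv_symm u v
  rw [key, key, sym]

/-- A surface with adapted frames whose first principal curvature vanishes is locally a
composition. -/
theorem exists_isCompositionOn (h : AdaptedFrame f U P θ θ' T T' N N')
    (hS : ∀ x ∈ U, ∃ m, StructureEqs a b 0 m (T x) (T' x) (N x) (N' x) (fderiv ℝ f x)
      (fderiv ℝ T x) (fderiv ℝ T' x) (fderiv ℝ N x) (fderiv ℝ N' x)) {x₀ : Euc 2} (hx₀ : x₀ ∈ U) :
    ∃ (O : Set (Euc 2)) (ψ : Euc 2 → Euc 2), IsOpen O ∧ ContDiffOn ℝ ∞ ψ O ∧ Set.MapsTo ψ O U ∧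
      x₀ ∈ ψ '' O ∧ IsCompositionOn (f ∘ ψ) O := by
  obtain ⟨r, hr, hrU⟩ := Metric.isOpen_iff.mp h.isOpen x₀ hx₀
  set B := Metric.ball x₀ r with hBdef
  have hBc : Convex ℝ B := convex_ball x₀ r
  have hBo : IsOpen B := Metric.isOpen_ball
  replace h := h.mono hBo hrU
  replace hS := fun x hx ↦ hS x (hrU hx)
  -- The connection form is closed because `dT` is along `T'` and `dT'` is orthogonal to `T'`. Its
  -- negative has a primitive `τ`, the angle of a planar frame turning as `T, T'` does.
  obtain ⟨τ, τs, hτ⟩ := exists_contDiffOn_primitive hBc hBo h.contDiffOn_connForm.neg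
    fun x hx u v ↦ by
      obtain ⟨m, hs⟩ := hS x hx
      have g := h.frame x hx
      obtain ⟨-, eT, eT', -⟩ := h.exists_ruled hx hs u
      obtain ⟨-, fT, fT', -⟩ := h.exists_ruled hx hs v
      have sym := (h.contDiffOn_T'.contDiffAt (h.isOpen.mem_nhds hx)).fderiv_symm u v
      rw [fderiv_fun_neg]
      simp only [neg_apply]
      rw [h.fderiv_connForm hx, h.fderiv_connForm hx, eT, eT', fT, fT', sym]
      simp [inner_add_right, real_inner_smul_left, real_inner_smul_right, g.swap.inner_T,
        g.inner_T'_N]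
  have dq (x) (hx : x ∈ B) := (hasDerivAt_rotVec (τ x)).hasFDerivAt.comp x (hτ x hx)
  have dq' (x) (hx : x ∈ B) := (hasDerivAt_rotVecPerp (τ x)).hasFDerivAt.comp x (hτ x hx)
  have qs : ContDiffOn ℝ ∞ (rotVec ∘ τ) B := contDiff_rotVec.comp_contDiffOn τs
  have qs' : ContDiffOn ℝ ∞ (rotVecPerp ∘ τ) B := contDiff_rotVecPerp.comp_contDiffOn τs
  have dqv (x) (hx : x ∈ B) (v) : fderiv ℝ (rotVec ∘ τ) x v =
      -connForm T T' x v • (rotVecPerp ∘ τ) x := by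
    rw [(dq x hx).fderiv]
    simp
  have dqv' (x) (hx : x ∈ B) (v) : fderiv ℝ (rotVecPerp ∘ τ) x v =
      connForm T T' x v • (rotVec ∘ τ) x := by
    rw [(dq' x hx).fderiv]
    simp
  -- `Ψ` is the developing map, which unrolls the surface isometrically onto the plane and sends `T,
  -- T'` to the rotating frame.
  obtain ⟨Ψ, Ψs, hΨ⟩ := exists_contDiffOn_primitive hBc hBo (h.contDiffOn_coframeForm qs qs')
    fun x hx u v ↦ h.fderiv_coframeForm_symm hS qs qs' dqv dqv' hx u v
  -- The coefficient `a` in the ruling `N' - a T'` is chosen so that the `N` components of `dN'` and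
  -- `a dT'` cancel; thus `d(N' - a T') = -a ω T`, with `ω` the connection form. `G` is the planar
  -- model of `Ft`, with the frame `T, T', N'` replaced by the rotating frame and the vertical
  -- direction.
  let G : Euc 2 × ℝ → Euc 2 × ℝ := fun w ↦ (Ψ w.1 - (a * w.2) • rotVecPerp (τ w.1), w.2)
  let Ft : Euc 2 × ℝ → Euc 4 := fun w ↦ f w.1 + w.2 • (N' w.1 - a • T' w.1)
  have hfst : Set.MapsTo Prod.fst (B ×ˢ (Set.univ : Set ℝ)) B := fun w hw ↦ hw.1
  have hfs : ContDiffOn ℝ ∞ (Prod.fst : Euc 2 × ℝ → Euc 2) (B ×ˢ Set.univ) :=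
    contDiff_fst.contDiffOn
  have hsn : ContDiffOn ℝ ∞ (Prod.snd : Euc 2 × ℝ → ℝ) (B ×ˢ Set.univ) :=
    contDiff_snd.contDiffOn
  have dG (w) (hw : w ∈ B ×ˢ (Set.univ : Set ℝ)) (v : Euc 2 × ℝ) : fderiv ℝ G w v =
      ((⟪T w.1, fderiv ℝ f w.1 v.1⟫ - a * w.2 * connForm T T' w.1 v.1) • rotVec (τ w.1) +
        (⟪T' w.1, fderiv ℝ f w.1 v.1⟫ - a * v.2) • rotVecPerp (τ w.1), v.2) := by
    have h1 : HasFDerivAt (fun w : Euc 2 × ℝ ↦ w.1) (ContinuousLinearMap.fst ℝ (Euc 2) ℝ) w :=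
      hasFDerivAt_fst
    have h2 : HasFDerivAt (fun w : Euc 2 × ℝ ↦ w.2) (ContinuousLinearMap.snd ℝ (Euc 2) ℝ) w :=
      hasFDerivAt_snd
    have h3 := (hΨ w.1 hw.1).comp w h1
    have h4 := (dq' w.1 hw.1).comp w h1
    have h5 := (h3.sub ((h2.const_mul a).smul h4)).prodMk h2
    have h6 : fderiv ℝ G w = _ := h5.fderiv
    rw [h6]
    ext1
    · simp [coframeForm_apply]
      module
    · simp
  have dFt (w) (hw : w ∈ B ×ˢ (Set.univ : Set ℝ)) (v : Euc 2 × ℝ) : fderiv ℝ Ft w v =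
      (⟪T w.1, fderiv ℝ f w.1 v.1⟫ - a * w.2 * connForm T T' w.1 v.1) • T w.1 +
        (⟪T' w.1, fderiv ℝ f w.1 v.1⟫ - a * v.2) • T' w.1 + v.2 • N' w.1 := by
    obtain ⟨m, hs⟩ := hS w.1 hw.1
    obtain ⟨-, -, eT', eN'⟩ := h.exists_ruled hw.1 hs v.1
    have h1 : HasFDerivAt (fun w : Euc 2 × ℝ ↦ w.1) (ContinuousLinearMap.fst ℝ (Euc 2) ℝ) w :=
      hasFDerivAt_fst
    have h2 : HasFDerivAt (fun w : Euc 2 × ℝ ↦ w.2) (ContinuousLinearMap.snd ℝ (Euc 2) ℝ) w :=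
      hasFDerivAt_snd
    obtain ⟨-, dT', -, dN'⟩ := h.differentiableAt hw.1
    have df := (h.contDiffOn.contDiffAt (h.isOpen.mem_nhds hw.1)).differentiableAt_infty
    have h3 := (df.hasFDerivAt.comp w h1).add (h2.smul ((dN'.hasFDerivAt.comp w h1).sub
      ((dT'.hasFDerivAt.comp w h1).const_smul a)))
    have h6 : fderiv ℝ Ft w = _ := h3.fderiv
    rw [h6]
    simp [eT', eN']
    conv_lhs => rw [h.fderiv_eq hw.1 v.1]
    module
  have hG : ContDiffOn ℝ ∞ G (B ×ˢ Set.univ) := by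
    have h1 : ContDiffOn ℝ ∞ (fun w : Euc 2 × ℝ ↦ a * w.2) (B ×ˢ Set.univ) :=
      contDiffOn_const.mul hsn
    exact ((Ψs.comp hfs hfst).sub (h1.smul (qs'.comp hfs hfst))).prodMk hsn
  have hFt : ContDiffOn ℝ ∞ Ft (B ×ˢ Set.univ) := by
    have h1 : ContDiffOn ℝ ∞ (fun w : Euc 2 × ℝ ↦ a • T' w.1) (B ×ˢ Set.univ) :=
      (h.contDiffOn_T'.comp hfs hfst).const_smul a
    exact (h.contDiffOn.comp hfs hfst).add (hsn.smul ((h.contDiffOn_N'.comp hfs hfst).sub h1))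
  obtain ⟨O, ψ, hO, hψ, hm, hx, hc⟩ := exists_isCompositionOn_of_thickening hBo (G := G) (Ft := Ft)
    (f := f) hG hFt
    (fun w ↦ rfl) (fun x ↦ by simp [Ft])
    (fun w hw ↦ by
      rw [injective_iff_map_eq_zero]
      intro v hv
      obtain ⟨m, hs⟩ := hS w.1 hw.1
      -- The connection form is a multiple of the coframe form of `T'`, so it vanishes on the kernel
      -- whatever the height. This is why the thickening needs no bound.
      obtain ⟨er, -⟩ := h.exists_ruled hw.1 hs v.1
      rw [dG w hw, Prod.mk_eq_zero] at hv
      obtain ⟨hv1, hv2⟩ := hv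
      have i1 := congrArg (fun y ↦ ⟪rotVecPerp (τ w.1), y⟫) hv1
      have i2 := congrArg (fun y ↦ ⟪rotVec (τ w.1), y⟫) hv1
      have o : ⟪rotVecPerp (τ w.1), rotVec (τ w.1)⟫ = 0 := by
        rw [real_inner_comm, inner_rotVec_perp]
      simp only [inner_add_right, real_inner_smul_right, o, inner_rotVecPerp_self, hv2,
        inner_zero_right] at i1
      simp only [inner_add_right, real_inner_smul_right, inner_rotVec_perp, inner_rotVec_self,
        inner_zero_right] at i2
      have t' : ⟪T' w.1, fderiv ℝ f w.1 v.1⟫ = 0 := by linarith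
      rw [er, t'] at i2
      have t : ⟪T w.1, fderiv ℝ f w.1 v.1⟫ = 0 := by linarith
      have z := h.fderiv_eq hw.1 v.1
      rw [t, t', zero_smul, zero_smul, zero_add] at z
      exact Prod.ext ((map_eq_zero_iff _ (h.injective _ hw.1)).mp z) hv2)
    (fun w hw u v ↦ by
      have g := h.frame w.1 hw.1
      rw [dG w hw, dG w hw, dFt w hw, dFt w hw]
      have o : ⟪rotVecPerp (τ w.1), rotVec (τ w.1)⟫ = 0 := by
        rw [real_inner_comm, inner_rotVec_perp]
      have o1 := g.swap.inner_T
      have o2 : ⟪N' w.1, T w.1⟫ = 0 := by rw [real_inner_comm, g.inner_T_N']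
      have o3 : ⟪N' w.1, T' w.1⟫ = 0 := by rw [real_inner_comm, g.inner_T'_N']
      simp only [inner_add_left, inner_add_right, real_inner_smul_left, real_inner_smul_right, o, o1,
        o2, o3, g.inner_T, g.inner_T_N', g.inner_T'_N', g.inner_self, g.inner_self',
        g.inner_selfN', inner_rotVec_self, inner_rotVecPerp_self, inner_rotVec_perp]
      ring)
    (Metric.mem_ball_self hr)
  exact ⟨O, ψ, hO, hψ, hm.mono_right hrU, hx, hc⟩

end AdaptedFrame

/-! ### Immersed surfaces with constant principal angles -/

/-- The structure equations at `x` of the frame of principal fields `T, T'` pulled back by `φ`,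
with principal curvatures `l` and `m`. -/
abbrev PullbackEqs {M : Type*} (i : M → Euc 4) (P : Submodule ℝ (Euc 4)) (θ θ' : ℝ) (T T' : M → Euc 4)
    (φ : Euc 2 → M) (x : Euc 2) (l m : ℝ) : Prop :=
  StructureEqs (angleCoeff θ θ') (-angleCoeff θ' θ) l m ((T ∘ φ) x) ((T' ∘ φ) x)
    ((principalNormal P θ ∘ T ∘ φ) x) ((principalNormal P θ' ∘ T' ∘ φ) x) (fderiv ℝ (i ∘ φ) x)
    (fderiv ℝ (T ∘ φ) x) (fderiv ℝ (T' ∘ φ) x) (fderiv ℝ (principalNormal P θ ∘ T ∘ φ) x)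
    (fderiv ℝ (principalNormal P θ' ∘ T' ∘ φ) x)

theorem PullbackEqs.swap {M : Type*} {i : M → Euc 4} {P : Submodule ℝ (Euc 4)} {θ θ' : ℝ}
    {T T' : M → Euc 4} {φ : Euc 2 → M} {x : Euc 2} {l m : ℝ}
    (h : PullbackEqs i P θ θ' T T' φ x l m) : PullbackEqs i P θ' θ T' T φ x m l := by
  have := StructureEqs.swap h
  rwa [neg_neg] at this

section Surface

variable {M : Type*} [TopologicalSpace M] [ChartedSpace (Euc 2) M]

/-- The surface has constant, distinct and nontrivial principal angles `θ, θ'` with the plane `P`,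
in either order. -/
structure ConstantAngles (i : M → Euc 4) (P : Submodule ℝ (Euc 4)) (θ θ' : ℝ) : Prop where
  immersion : IsSurfaceImmersion i
  finrank_eq : Module.finrank ℝ P = 2
  cos_ne : Real.cos θ ≠ 0
  cos_ne' : Real.cos θ' ≠ 0
  sin_ne : Real.sin θ ≠ 0
  sin_ne' : Real.sin θ' ≠ 0
  disc_ne : angleDisc θ θ' ≠ 0
  exists_principal : ∀ p, ∃ v v' w w', PrincipalVectors (tangentPlane i p) P θ θ' v v' w w'

variable {i : M → Euc 4} {P : Submodule ℝ (Euc 4)} {θ θ' : ℝ}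

theorem ConstantAngles.swap (h : ConstantAngles i P θ θ') : ConstantAngles i P θ' θ where
  immersion := h.immersion
  finrank_eq := h.finrank_eq
  cos_ne := h.cos_ne'
  cos_ne' := h.cos_ne
  sin_ne := h.sin_ne'
  sin_ne' := h.sin_ne
  disc_ne := by rw [angleDisc_swap]; exact neg_ne_zero.mpr h.disc_ne
  exists_principal p := by
    obtain ⟨v, v', w, w', hv⟩ := h.exists_principal p
    exact ⟨v', v, w', w, hv.swap⟩

theorem ConstantAngles.sq_ne (h : ConstantAngles i P θ θ') : Real.cos θ ^ 2 ≠ Real.cos θ' ^ 2 := by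
  have := h.disc_ne
  rw [angleDisc_eq] at this
  exact sub_ne_zero.mp this

theorem ConstantAngles.angleCoeff_ne (h : ConstantAngles i P θ θ') : angleCoeff θ θ' ≠ 0 :=
  div_ne_zero (mul_ne_zero h.cos_ne' h.sin_ne') h.disc_ne

theorem IsSurfaceImmersion.finrank_tangentPlane (hi : IsSurfaceImmersion i) (p : M) :
    Module.finrank ℝ (tangentPlane i p) = 2 := by
  have : Function.Injective (surfDeriv i p : Euc 2 →ₗ[ℝ] Euc 4) := hi.injective_mfderiv p
  rw [tangentPlane, LinearMap.finrank_range_of_inj this]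
  simp

theorem IsTangentField.mono {V V' : Set M} {Y : M → Euc 4} (h : IsTangentField i V Y)
    (hV' : IsOpen V') (hs : V' ⊆ V) : IsTangentField i V' Y :=
  ⟨hV', h.contMDiffOn.mono hs, fun q hq ↦ h.mem_tangentPlane q (hs hq)⟩

theorem IsPrincipalField.mono {V V' : Set M} {T : M → Euc 4} (h : IsPrincipalField i P θ V T)
    (hV' : IsOpen V') (hs : V' ⊆ V) : IsPrincipalField i P θ V' T :=
  ⟨h.1.mono hV' hs, fun q hq ↦ h.2 q (hs hq)⟩

/-- A smooth regular map of the open subset `U` of the plane into the surface. -/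
structure LocalParam (i : M → Euc 4) (φ : Euc 2 → M) (U : Set (Euc 2)) : Prop where
  isOpen : IsOpen U
  contMDiffOn : ContMDiffOn (𝓡 2) (𝓡 2) ∞ φ U
  injective : ∀ x ∈ U, Function.Injective (fderiv ℝ (i ∘ φ) x)

theorem LocalParam.contDiffOn {φ : Euc 2 → M} {U : Set (Euc 2)} (h : LocalParam i φ U)
    {V : Set M} {Y : M → Euc 4} (hY : ContMDiffOn (𝓡 2) 𝓘(ℝ, Euc 4) ∞ Y V)
    (hm : Set.MapsTo φ U V) : ContDiffOn ℝ ∞ (Y ∘ φ) U :=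
  contMDiffOn_iff_contDiffOn.mp (hY.comp h.contMDiffOn hm)

theorem LocalParam.mono {φ : Euc 2 → M} {U U' : Set (Euc 2)} (h : LocalParam i φ U)
    (hU' : IsOpen U') (hs : U' ⊆ U) : LocalParam i φ U' :=
  ⟨hU', h.contMDiffOn.mono hs, fun x hx ↦ h.injective x (hs hx)⟩

theorem LocalParam.isOpen_inter {φ : Euc 2 → M} {U : Set (Euc 2)} (h : LocalParam i φ U)
    {V : Set M} (hV : IsOpen V) : IsOpen (U ∩ φ ⁻¹' V) :=
  h.contMDiffOn.continuousOn.isOpen_inter_preimage h.isOpen hV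

/-- The chain rule for the composition of a field on the surface with a parametrization. -/
theorem fderiv_comp_param {φ : Euc 2 → M} {U : Set (Euc 2)} (hU : IsOpen U)
    (hφ : ContMDiffOn (𝓡 2) (𝓡 2) ∞ φ U) {x : Euc 2} (hx : x ∈ U) :
    ∃ A : Euc 2 →L[ℝ] Euc 2, ∀ (V : Set M) (Y : M → Euc 4), IsOpen V → φ x ∈ V →
      ContMDiffOn (𝓡 2) 𝓘(ℝ, Euc 4) ∞ Y V → ∀ u, fderiv ℝ (Y ∘ φ) x u = surfDeriv Y (φ x) (A u) := by
  refine ⟨mfderiv (𝓡 2) (𝓡 2) φ x, fun V Y hV hxV hY u ↦ ?_⟩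
  have h1 : MDifferentiableAt (𝓡 2) (𝓡 2) φ x :=
    (hφ.contMDiffAt (hU.mem_nhds hx)).mdifferentiableAt (by simp)
  have h2 : MDifferentiableAt (𝓡 2) 𝓘(ℝ, Euc 4) Y (φ x) :=
    (hY.contMDiffAt (hV.mem_nhds hxV)).mdifferentiableAt (by simp)
  rw [← mfderiv_eq_fderiv, mfderiv_comp x h2 h1]
  rfl

/-- The differential of `φ` is injective because that of `i ∘ φ` is, hence bijective in dimension
two. Every tangent vector of the surface at `φ x` can thus be pulled back. -/
theorem LocalParam.exists_equiv {φ : Euc 2 → M} {U : Set (Euc 2)} (h : LocalParam i φ U)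
    (hi : IsSurfaceImmersion i) {x : Euc 2} (hx : x ∈ U) :
    ∃ A : Euc 2 ≃ₗ[ℝ] Euc 2, ∀ (V : Set M) (Y : M → Euc 4), IsOpen V → φ x ∈ V →
      ContMDiffOn (𝓡 2) 𝓘(ℝ, Euc 4) ∞ Y V → ∀ u, fderiv ℝ (Y ∘ φ) x u = surfDeriv Y (φ x) (A u) := by
  obtain ⟨A, hA⟩ := fderiv_comp_param h.isOpen h.contMDiffOn hx
  have hinj : Function.Injective (A : Euc 2 →ₗ[ℝ] Euc 2) := by
    intro u v huv
    have huv' : A u = A v := huv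
    apply h.injective x hx
    have e := hA Set.univ i isOpen_univ trivial hi.contMDiff.contMDiffOn
    rw [e, e, huv']
  exact ⟨LinearEquiv.ofInjectiveEndo _ hinj, hA⟩

theorem LocalParam.range_eq {φ : Euc 2 → M} {U : Set (Euc 2)} (h : LocalParam i φ U)
    (hi : IsSurfaceImmersion i) {x : Euc 2} (hx : x ∈ U) :
    LinearMap.range (fderiv ℝ (i ∘ φ) x : Euc 2 →ₗ[ℝ] Euc 4) = tangentPlane i (φ x) := by
  obtain ⟨A, hA⟩ := h.exists_equiv hi hx
  have e := hA Set.univ i isOpen_univ trivial hi.contMDiff.contMDiffOn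
  ext z
  constructor
  · rintro ⟨u, rfl⟩
    exact ⟨A u, (e u).symm⟩
  · rintro ⟨v, rfl⟩
    refine ⟨A.symm v, (e _).trans ?_⟩
    rw [A.apply_symm_apply]
    rfl

theorem contDiff_principalNormal (P : Submodule ℝ (Euc 4)) (θ : ℝ) :
    ContDiff ℝ ∞ (principalNormal P θ) := by
  unfold principalNormal
  fun_prop

/-- The adapted frame of principal fields, pulled back by a parametrization. -/
theorem ConstantAngles.adaptedFrame (hA : ConstantAngles i P θ θ') {φ : Euc 2 → M}
    {U : Set (Euc 2)} (h : LocalParam i φ U) {V : Set M} {T T' : M → Euc 4}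
    (hT : IsPrincipalField i P θ V T) (hT' : IsPrincipalField i P θ' V T')
    (hm : Set.MapsTo φ U V) :
    AdaptedFrame (i ∘ φ) U P θ θ' (T ∘ φ) (T' ∘ φ) (principalNormal P θ ∘ T ∘ φ)
      (principalNormal P θ' ∘ T' ∘ φ) where
  isOpen := h.isOpen
  contDiffOn := h.contDiffOn hA.immersion.contMDiff.contMDiffOn (Set.mapsTo_univ φ U)
  contDiffOn_T := h.contDiffOn hT.1.contMDiffOn hm
  contDiffOn_T' := h.contDiffOn hT'.1.contMDiffOn hm
  contDiffOn_N := (contDiff_principalNormal P θ).comp_contDiffOn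
    (h.contDiffOn hT.1.contMDiffOn hm)
  contDiffOn_N' := (contDiff_principalNormal P θ').comp_contDiffOn
    (h.contDiffOn hT'.1.contMDiffOn hm)
  injective := h.injective
  frame x hx := by
    rw [h.range_eq hA.immersion hx]
    obtain ⟨v, v', w, w', hv⟩ := hA.exists_principal (φ x)
    exact hv.pointFrame (hA.immersion.finrank_tangentPlane _) hA.finrank_eq hA.sq_ne hA.cos_ne
      hA.cos_ne' hA.sin_ne hA.sin_ne' (hT.2 _ (hm hx)) (hT'.2 _ (hm hx))

/-! ### Geodesic fields and first normal spaces in terms of the principal curvatures -/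

section Pullback

variable {φ : Euc 2 → M} {U : Set (Euc 2)} {V : Set M} {T T' : M → Euc 4} {x : Euc 2} {l m : ℝ}

theorem ConstantAngles.exists_pullbackEqs (hA : ConstantAngles i P θ θ') (h : LocalParam i φ U)
    (hT : IsPrincipalField i P θ V T) (hT' : IsPrincipalField i P θ' V T')
    (hm : Set.MapsTo φ U V) (hx : x ∈ U) : ∃ l m, PullbackEqs i P θ θ' T T' φ x l m :=
  (hA.adaptedFrame h hT hT' hm).exists_structureEqs hA.finrank_eq hA.disc_ne hx

/-- The principal field `T` is geodesic where its principal curvature vanishes. -/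
theorem ConstantAngles.geodesic_iff (hA : ConstantAngles i P θ θ') (h : LocalParam i φ U)
    (hT : IsPrincipalField i P θ V T) (hT' : IsPrincipalField i P θ' V T')
    (hm : Set.MapsTo φ U V) (hx : x ∈ U) (hs : PullbackEqs i P θ θ' T T' φ x l m) :
    (∀ v : Euc 2, surfDeriv i (φ x) v = T (φ x) → leviCivita i T (φ x) v = 0) ↔ l = 0 := by
  have hF := hA.adaptedFrame h hT hT' hm
  have g := hF.frame x hx
  rw [h.range_eq hA.immersion hx] at g
  obtain ⟨A, hAd⟩ := h.exists_equiv hA.immersion hx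
  have ei := hAd Set.univ i isOpen_univ trivial hA.immersion.contMDiff.contMDiffOn
  have eT := hAd V T hT.1.isOpen (hm hx) hT.1.contMDiffOn
  -- The tangential part of the structure equation for `dT` in the direction `T`. Since `angleCoeff
  -- θ θ'` is nonzero, it vanishes only with `l`.
  have key (u : Euc 2) (hu : fderiv ℝ (i ∘ φ) x u = (T ∘ φ) x) :
      leviCivita i T (φ x) (A u) = -(angleCoeff θ θ' * l) • (T' ∘ φ) x := by
    rw [leviCivita, ← eT, hs.dT, hu, g.inner_self, g.swap.inner_T, map_add, map_smul, map_smul, Submodule.starProjection_eq_self_iff.mpr g.mem',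
      (Submodule.starProjection_apply_eq_zero_iff _).mpr g.memN']
    simp
  constructor
  · intro hg
    obtain ⟨u, hu⟩ := hF.exists_preimage hx
    have := hg (A u) ((ei u).symm.trans hu)
    rw [key u hu, smul_eq_zero, neg_eq_zero, mul_eq_zero] at this
    rcases this with (h0 | h0) | h0
    · exact absurd h0 hA.angleCoeff_ne
    · exact h0
    · have := g.norm'
      rw [h0, norm_zero] at this
      exact absurd this zero_ne_one
  · rintro rfl v hv
    have hu : fderiv ℝ (i ∘ φ) x (A.symm v) = (T ∘ φ) x := by
      rw [ei, A.apply_symm_apply]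
      exact hv
    have := key _ hu
    rw [A.apply_symm_apply] at this
    rw [this]
    simp

/-- The first normal space is spanned by the principal curvature vectors. -/
theorem ConstantAngles.firstNormalSpace_eq (hA : ConstantAngles i P θ θ') (h : LocalParam i φ U)
    (hT : IsPrincipalField i P θ V T) (hT' : IsPrincipalField i P θ' V T')
    (hm : Set.MapsTo φ U V) (hx : x ∈ U) (hs : PullbackEqs i P θ θ' T T' φ x l m) :
    firstNormalSpace i (φ x) = Submodule.span ℝ {l • principalNormal P θ' (T' (φ x)),
      m • principalNormal P θ (T (φ x))} := by
  have hF := hA.adaptedFrame h hT hT' hm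
  have g := hF.frame x hx
  rw [h.range_eq hA.immersion hx] at g
  obtain ⟨A, hAd⟩ := h.exists_equiv hA.immersion hx
  have ei := hAd Set.univ i isOpen_univ trivial hA.immersion.contMDiff.contMDiffOn
  have normal (z : Euc 4) (hz : z ∈ tangentPlane i (φ x)) :
      (tangentPlane i (φ x))ᗮ.starProjection z = 0 :=
    Submodule.starProjection_orthogonal_apply_eq_zero hz
  have nT (u : Euc 2) : (tangentPlane i (φ x))ᗮ.starProjection (fderiv ℝ (T ∘ φ) x u) =
      (l * ⟪(T ∘ φ) x, fderiv ℝ (i ∘ φ) x u⟫) • (principalNormal P θ' ∘ T' ∘ φ) x := by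
    rw [hs.dT, map_add, map_smul, map_smul, normal _ g.mem', smul_zero, zero_add,
      Submodule.starProjection_eq_self_iff.mpr g.memN']
  have nT' (u : Euc 2) : (tangentPlane i (φ x))ᗮ.starProjection (fderiv ℝ (T' ∘ φ) x u) =
      (m * ⟪(T' ∘ φ) x, fderiv ℝ (i ∘ φ) x u⟫) • (principalNormal P θ ∘ T ∘ φ) x := by
    rw [hs.dT', map_add, map_smul, map_smul, normal _ g.mem, smul_zero, zero_add,
      Submodule.starProjection_eq_self_iff.mpr g.memN]
  apply le_antisymm
  · rw [firstNormalSpace, Submodule.span_le]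
    rintro _ ⟨V', Y, v, hxV', hY, rfl⟩
    have eY := hAd V' Y hY.isOpen hxV' hY.contMDiffOn
    have hV : U ∩ φ ⁻¹' V' ∈ 𝓝 x := (h.isOpen_inter hY.isOpen).mem_nhds ⟨hx, hxV'⟩
    have dY : DifferentiableAt ℝ (Y ∘ φ) x :=
      (((h.mono (h.isOpen_inter hY.isOpen) Set.inter_subset_left).contDiffOn hY.contMDiffOn
        fun y hy ↦ hy.2).contDiffAt hV).differentiableAt_infty
    obtain ⟨dT, dT', -, -⟩ := hF.differentiableAt hx
    -- Expand `Y` in the principal frame: derivatives of its coefficients multiply tangent vectors,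
    -- so the normal projection kills them.
    have e : Y ∘ φ =ᶠ[𝓝 x] fun y ↦ ⟪(T ∘ φ) y, (Y ∘ φ) y⟫ • (T ∘ φ) y +
        ⟪(T' ∘ φ) y, (Y ∘ φ) y⟫ • (T' ∘ φ) y := by
      filter_upwards [hV] with y hy
      have gy := hF.frame y hy.1
      rw [h.range_eq hA.immersion hy.1] at gy
      exact eq_add_of_mem_plane (hA.immersion.finrank_tangentPlane _) gy.mem gy.mem' gy.norm
        gy.norm' gy.inner_T (hY.mem_tangentPlane _ hy.2)
    have i1 := dT.inner ℝ dY
    have i2 := dT'.inner ℝ dY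
    have val : secondFundForm i Y (φ x) v =
        (⟪(T ∘ φ) x, (Y ∘ φ) x⟫ * ⟪(T ∘ φ) x, fderiv ℝ (i ∘ φ) x (A.symm v)⟫) •
          (l • principalNormal P θ' (T' (φ x))) +
        (⟪(T' ∘ φ) x, (Y ∘ φ) x⟫ * ⟪(T' ∘ φ) x, fderiv ℝ (i ∘ φ) x (A.symm v)⟫) •
          (m • principalNormal P θ (T (φ x))) := by
      have e' := eY (A.symm v)
      rw [A.apply_symm_apply] at e'
      rw [secondFundForm, ← e', e.fderiv_eq, fderiv_fun_add (i1.fun_smul dT) (i2.fun_smul dT'),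
        fderiv_fun_smul i1 dT, fderiv_fun_smul i2 dT']
      simp only [add_apply, smul_apply, ContinuousLinearMap.smulRight_apply, map_add, map_smul,
        normal _ g.mem, normal _ g.mem', nT, nT', smul_zero, add_zero]
      simp only [Function.comp_apply]
      module
    rw [val]
    exact Submodule.add_mem _
      (Submodule.smul_mem _ _ (Submodule.subset_span (Set.mem_insert _ _)))
      (Submodule.smul_mem _ _ (Submodule.subset_span (Set.mem_insert_of_mem _ rfl)))
  · rw [Submodule.span_le]
    rintro _ (rfl | rfl)
    · obtain ⟨u, hu⟩ := hF.exists_preimage hx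
      refine Submodule.subset_span ⟨V, T, A u, hm hx, hT.1, ?_⟩
      rw [secondFundForm, ← hAd V T hT.1.isOpen (hm hx) hT.1.contMDiffOn, nT, hu, g.inner_self,
        mul_one]
      rfl
    · obtain ⟨u, hu⟩ := hF.swap.exists_preimage hx
      refine Submodule.subset_span ⟨V, T', A u, hm hx, hT'.1, ?_⟩
      rw [secondFundForm, ← hAd V T' hT'.1.isOpen (hm hx) hT'.1.contMDiffOn, nT', hu,
        g.inner_self', mul_one]
      rfl

end Pullback

end Surface

/-! ### Local principal fields, and the main theorem -/

section Surface

variable {M : Type*} [TopologicalSpace M] [ChartedSpace (Euc 2) M]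
  {i : M → Euc 4} {P : Submodule ℝ (Euc 4)} {θ θ' : ℝ}

theorem localParam_chart [IsManifold (𝓡 2) ∞ M] (hi : IsSurfaceImmersion i) (p : M) :
    LocalParam i (chartAt (Euc 2) p).symm (chartAt (Euc 2) p).target where
  isOpen := (chartAt (Euc 2) p).open_target
  contMDiffOn := contMDiffOn_chart_symm
  injective x hx := by
    have hc : (chartAt (Euc 2) p).MDifferentiable (𝓡 2) (𝓡 2) :=
      mdifferentiable_chart (I := 𝓡 2) p
    have h1 := hc.symm.mfderiv_injective (x := x) hx
    have h2 : MDifferentiableAt (𝓡 2) (𝓡 2) (chartAt (Euc 2) p).symm x :=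
      hc.mdifferentiableAt_symm hx
    have h3 : MDifferentiableAt (𝓡 2) 𝓘(ℝ, Euc 4) i ((chartAt (Euc 2) p).symm x) :=
      (hi.contMDiff _).mdifferentiableAt (by simp)
    rw [← mfderiv_eq_fderiv, mfderiv_comp x h3 h2]
    exact (hi.injective_mfderiv _).comp h1

/-- A smooth tangent field of the principal direction of angle `θ`, where it does not vanish. It
is written in terms of the tangent fields `fderiv ℝ f x eⱼ` and `fderiv ℝ f x u`. -/
def principalCandidate (f : Euc 2 → Euc 4) (P : Submodule ℝ (Euc 4)) (θ : ℝ) (u x : Euc 2) :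
    Euc 4 :=
  let B := fun v w : Euc 2 ↦ ⟪P.starProjection (fderiv ℝ f x v), P.starProjection (fderiv ℝ f x w)⟫ -
    Real.cos θ ^ 2 * ⟪fderiv ℝ f x v, fderiv ℝ f x w⟫
  fderiv ℝ f x (B u (EuclideanSpace.single 1 1) • EuclideanSpace.single 0 1 -
    B u (EuclideanSpace.single 0 1) • EuclideanSpace.single 1 1)

theorem contDiffOn_principalCandidate {f : Euc 2 → Euc 4} {U : Set (Euc 2)}
    (hf : ContDiffOn ℝ ∞ f U) (hU : IsOpen U) (P : Submodule ℝ (Euc 4)) (θ : ℝ) (u : Euc 2) :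
    ContDiffOn ℝ ∞ (principalCandidate f P θ u) U := by
  have df : ContDiffOn ℝ ∞ (fderiv ℝ f) U := hf.fderiv_of_isOpen hU (by simp)
  have dv (v : Euc 2) : ContDiffOn ℝ ∞ (fun x ↦ fderiv ℝ f x v) U := df.clm_apply contDiffOn_const
  have dB (v w : Euc 2) : ContDiffOn ℝ ∞ (fun x ↦
      ⟪P.starProjection (fderiv ℝ f x v), P.starProjection (fderiv ℝ f x w)⟫ -
        Real.cos θ ^ 2 * ⟪fderiv ℝ f x v, fderiv ℝ f x w⟫) U :=
    ((P.starProjection.contDiff.comp_contDiffOn (dv v)).inner ℝ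
      (P.starProjection.contDiff.comp_contDiffOn (dv w))).sub
      (contDiffOn_const.mul ((dv v).inner ℝ (dv w)))
  exact df.clm_apply (((dB _ _).smul contDiffOn_const).sub ((dB _ _).smul contDiffOn_const))

/-- The form `B` of the candidate represents `S - cos² θ`, which has rank one and is a multiple of
the square of `⟪v', ·⟫`. The candidate is therefore annihilated by `⟪v', ·⟫`, that is, parallel to
`v`. -/
theorem PrincipalVectors.principalCandidate_eq {f : Euc 2 → Euc 4} {x : Euc 2}
    {v v' w w' : Euc 4} (h : PrincipalVectors (LinearMap.range (fderiv ℝ f x : Euc 2 →ₗ[ℝ] Euc 4))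
      P θ θ' v v' w w')
    (hV : Module.finrank ℝ (LinearMap.range (fderiv ℝ f x : Euc 2 →ₗ[ℝ] Euc 4)) = 2)
    (hP : Module.finrank ℝ P = 2) (u : Euc 2) :
    principalCandidate f P θ u x = fderiv ℝ f x
      (((Real.cos θ' ^ 2 - Real.cos θ ^ 2) * ⟪v', fderiv ℝ f x u⟫) •
        (⟪v', fderiv ℝ f x (EuclideanSpace.single 1 1)⟫ • EuclideanSpace.single 0 1 -
        ⟪v', fderiv ℝ f x (EuclideanSpace.single 0 1)⟫ • EuclideanSpace.single 1 1)) := by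
  have key (a b : Euc 2) : ⟪P.starProjection (fderiv ℝ f x a), P.starProjection (fderiv ℝ f x b)⟫ -
      Real.cos θ ^ 2 * ⟪fderiv ℝ f x a, fderiv ℝ f x b⟫ =
      (Real.cos θ' ^ 2 - Real.cos θ ^ 2) * ⟪v', fderiv ℝ f x a⟫ * ⟪v', fderiv ℝ f x b⟫ := by
    have ha : fderiv ℝ f x a ∈ LinearMap.range (fderiv ℝ f x : Euc 2 →ₗ[ℝ] Euc 4) := ⟨a, rfl⟩
    have e := eq_add_of_mem_plane hV h.mem h.mem' h.norm h.norm' h.inner_V ha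
    have hb : fderiv ℝ f x b ∈ LinearMap.range (fderiv ℝ f x : Euc 2 →ₗ[ℝ] Euc 4) := ⟨b, rfl⟩
    rw [h.inner_starProjection hV hP ha hb]
    conv_lhs => enter [2, 2]; rw [e, inner_add_left, real_inner_smul_left, real_inner_smul_left]
    ring
  simp only [principalCandidate, key]
  congr 1
  module

/-- `l N'` and `m N` are orthogonal vectors of the line `N₁`, so one of them is zero. -/
theorem ConstantAngles.mul_eq_zero_of_finrank (hA : ConstantAngles i P θ θ') {φ : Euc 2 → M}
    {U : Set (Euc 2)} (h : LocalParam i φ U) {V : Set M} {T T' : M → Euc 4}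
    (hT : IsPrincipalField i P θ V T) (hT' : IsPrincipalField i P θ' V T')
    (hm : Set.MapsTo φ U V) {x : Euc 2} (hx : x ∈ U) {l m : ℝ}
    (hs : PullbackEqs i P θ θ' T T' φ x l m)
    (hN : Module.finrank ℝ (firstNormalSpace i (φ x)) = 1) : l * m = 0 := by
  have g := (hA.adaptedFrame h hT hT' hm).frame x hx
  have hl : l • principalNormal P θ' (T' (φ x)) ∈ firstNormalSpace i (φ x) := by
    rw [hA.firstNormalSpace_eq h hT hT' hm hx hs]
    exact Submodule.subset_span (Set.mem_insert _ _)
  have hm' : m • principalNormal P θ (T (φ x)) ∈ firstNormalSpace i (φ x) := by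
    rw [hA.firstNormalSpace_eq h hT hT' hm hx hs]
    exact Submodule.subset_span (Set.mem_insert_of_mem _ rfl)
  have o : ⟪principalNormal P θ' (T' (φ x)), principalNormal P θ (T (φ x))⟫ = 0 := g.swap.inner_N
  have n : ‖principalNormal P θ (T (φ x))‖ = 1 := g.normN
  have n' : ‖principalNormal P θ' (T' (φ x))‖ = 1 := g.normN'
  rcases eq_zero_or_eq_zero_of_finrank_eq_one hN hl hm' (by
    rw [real_inner_smul_left, real_inner_smul_right, o, mul_zero, mul_zero]) with h0 | h0
  · have := congrArg norm h0
    rw [norm_smul, n', mul_one, norm_zero, norm_eq_zero] at this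
    rw [this, zero_mul]
  · have := congrArg norm h0
    rw [norm_smul, n, mul_one, norm_zero, norm_eq_zero] at this
    rw [this, mul_zero]

/-- Principal fields exist locally. -/
theorem ConstantAngles.exists_principalField [IsManifold (𝓡 2) ∞ M]
    (hA : ConstantAngles i P θ θ') (p : M) : ∃ V T, p ∈ V ∧ IsPrincipalField i P θ V T := by
  set e := chartAt (Euc 2) p with he
  have hp := localParam_chart hA.immersion p
  rw [← he] at hp
  set f := i ∘ e.symm with hf
  have fs : ContDiffOn ℝ ∞ f e.target :=
    hp.contDiffOn hA.immersion.contMDiff.contMDiffOn (Set.mapsTo_univ _ _)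
  have hpe : p ∈ e.source := mem_chart_source (Euc 2) p
  have hx₀ : e p ∈ e.target := e.map_source hpe
  have vecs (x) (hx : x ∈ e.target) : ∃ v v' w w',
      PrincipalVectors (LinearMap.range (fderiv ℝ f x : Euc 2 →ₗ[ℝ] Euc 4)) P θ θ' v v' w w' := by
    rw [hp.range_eq hA.immersion hx]
    exact hA.exists_principal _
  have fr (x) (hx : x ∈ e.target) :
      Module.finrank ℝ (LinearMap.range (fderiv ℝ f x : Euc 2 →ₗ[ℝ] Euc 4)) = 2 := by
    rw [hp.range_eq hA.immersion hx]
    exact hA.immersion.finrank_tangentPlane _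
  obtain ⟨v, v', w, w', hv⟩ := vecs _ hx₀
  -- Taking `u` over the other principal vector `v'` at `p` makes the factor `⟪v', df u⟫` equal to
  -- `1` there, so the candidate is nonzero near `p`.
  obtain ⟨u, hu⟩ := hv.mem'
  have hu' : fderiv ℝ f (e p) u = v' := hu
  have hne : principalCandidate f P θ u (e p) ≠ 0 := by
    rw [hv.principalCandidate_eq (fr _ hx₀) hA.finrank_eq, hu', real_inner_self_eq_norm_sq, hv.norm']
    intro h0
    have h1 := (map_eq_zero_iff _ (hp.injective _ hx₀)).mp h0
    rw [smul_eq_zero] at h1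
    rcases h1 with h1 | h1
    · rw [one_pow, mul_one] at h1
      exact hA.sq_ne (sub_eq_zero.mp h1).symm
    -- Otherwise `v'` would be orthogonal to the images of both basis vectors, hence to `df u = v'`.
    · have c0 := congrArg (fun y : Euc 2 ↦ y 0) h1
      have c1 := congrArg (fun y : Euc 2 ↦ y 1) h1
      simp at c0 c1
      have ue : u = u 0 • EuclideanSpace.single 0 1 + u 1 • EuclideanSpace.single 1 1 := by
        ext j
        fin_cases j <;> simp
      have : ⟪v', fderiv ℝ f (e p) u⟫ = 1 := by
        rw [hu', real_inner_self_eq_norm_sq, hv.norm', one_pow]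
      rw [ue, map_add, map_smul, map_smul, inner_add_right, real_inner_smul_right,
        real_inner_smul_right, c0, c1] at this
      simp at this
  have cs := contDiffOn_principalCandidate fs e.open_target P θ u
  set O := e.target ∩ principalCandidate f P θ u ⁻¹' {0}ᶜ with hO
  have hOo : IsOpen O := cs.continuousOn.isOpen_inter_preimage e.open_target isOpen_compl_singleton
  have ts : ContDiffOn ℝ ∞ (fun x ↦ ‖principalCandidate f P θ u x‖⁻¹ •
      principalCandidate f P θ u x) O := by
    have cs' := cs.mono (Set.inter_subset_left : O ⊆ _)
    exact ((cs'.norm ℝ fun x hx ↦ hx.2).inv fun x hx ↦ norm_ne_zero_iff.mpr hx.2).smul cs'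
  have unit (x) (hx : x ∈ O) : IsPrincipalUnit (tangentPlane i (e.symm x)) P θ
      (‖principalCandidate f P θ u x‖⁻¹ • principalCandidate f P θ u x) := by
    obtain ⟨v, v', w, w', hv⟩ := vecs x hx.1
    rw [← hp.range_eq hA.immersion hx.1]
    refine hv.isPrincipalUnit (fr x hx.1) hA.finrank_eq (Submodule.smul_mem _ _ ⟨_, rfl⟩) ?_ ?_
    · rw [norm_smul, norm_inv, norm_norm, inv_mul_cancel₀ (norm_ne_zero_iff.mpr hx.2)]
    · rw [hv.principalCandidate_eq (fr x hx.1) hA.finrank_eq, map_smul, map_sub, map_smul, map_smul,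
        real_inner_smul_right, real_inner_smul_right, inner_sub_right, real_inner_smul_right,
        real_inner_smul_right]
      ring
  refine ⟨e.source ∩ e ⁻¹' O, (fun x ↦ ‖principalCandidate f P θ u x‖⁻¹ •
      principalCandidate f P θ u x) ∘ e, ⟨hpe, hx₀, hne⟩,
    ⟨e.isOpen_inter_preimage hOo, ?_, fun q hq ↦ ?_⟩, fun q hq ↦ ?_⟩
  · have he' : ContMDiffOn (𝓡 2) (𝓡 2) ∞ e e.source := contMDiffOn_chart
    exact ts.contMDiffOn.comp (he'.mono Set.inter_subset_left) fun q hq ↦ hq.2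
  · have := (unit _ hq.2).2.1
    rwa [e.left_inv hq.1] at this
  · have := unit _ hq.2
    rwa [e.left_inv hq.1] at this

/-- Both principal fields exist on a common neighbourhood. -/
theorem ConstantAngles.exists_principalFields [IsManifold (𝓡 2) ∞ M]
    (hA : ConstantAngles i P θ θ') (p : M) :
    ∃ V T T', p ∈ V ∧ IsPrincipalField i P θ V T ∧ IsPrincipalField i P θ' V T' := by
  obtain ⟨V, T, hp, hT⟩ := hA.exists_principalField p
  obtain ⟨V', T', hp', hT'⟩ := hA.swap.exists_principalField p
  have hV := hT.1.isOpen.inter hT'.1.isOpen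
  exact ⟨V ∩ V', T, T', ⟨hp, hp'⟩, hT.mono hV Set.inter_subset_left,
    hT'.mono hV Set.inter_subset_right⟩

/-- The chart at `p`, restricted to a neighbourhood of `p`. -/
theorem exists_localParam [IsManifold (𝓡 2) ∞ M] (hi : IsSurfaceImmersion i) {p : M} {V : Set M}
    (hV : IsOpen V) (hp : p ∈ V) : ∃ U, LocalParam i (chartAt (Euc 2) p).symm U ∧
      U ⊆ (chartAt (Euc 2) p).target ∧
      Set.MapsTo (chartAt (Euc 2) p).symm U V ∧ chartAt (Euc 2) p p ∈ U := by
  have h := localParam_chart hi p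
  refine ⟨_, h.mono (h.isOpen_inter hV) Set.inter_subset_left, Set.inter_subset_left,
    fun x hx ↦ hx.2, mem_chart_target _ _, ?_⟩
  rwa [Set.mem_preimage, (chartAt (Euc 2) p).left_inv (mem_chart_source _ _)]

/-- The condition `m ≠ 0` is open and `l m = 0` everywhere, so `l` vanishes near `p` and not only at
`p`. -/
theorem ConstantAngles.geodesic_of_eq_zero [IsManifold (𝓡 2) ∞ M] (hA : ConstantAngles i P θ θ')
    (hN : ∀ p, Module.finrank ℝ (firstNormalSpace i p) = 1)
    {V : Set M} {T T' : M → Euc 4} (hT : IsPrincipalField i P θ V T)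
    (hT' : IsPrincipalField i P θ' V T') {p : M} (hp : p ∈ V) {m : ℝ} (hm0 : m ≠ 0)
    (hs : PullbackEqs i P θ θ' T T' (chartAt (Euc 2) p).symm (chartAt (Euc 2) p p) 0 m) :
    ∃ V T, p ∈ V ∧ IsPrincipalField i P θ V T ∧ IsGeodesicField i V T := by
  obtain ⟨U, hU, hUt, hm, hpU⟩ := exists_localParam hA.immersion hT.1.isOpen hp
  set e := chartAt (Euc 2) p with he
  have hF := hA.adaptedFrame hU hT hT' hm
  obtain ⟨u, hu⟩ := hF.swap.exists_preimage hpU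
  -- the second principal curvature stays nonzero
  have hval (y) (hy : y ∈ U) (l m : ℝ) (hs : PullbackEqs i P θ θ' T T' e.symm y l m) :
      ⟪(principalNormal P θ ∘ T ∘ e.symm) y, fderiv ℝ (T' ∘ e.symm) y u⟫ =
        m * ⟪(T' ∘ e.symm) y, fderiv ℝ (i ∘ e.symm) y u⟫ := by
    have g := hF.frame y hy
    rw [hs.dT', inner_add_right, real_inner_smul_right, real_inner_smul_right, g.inner_selfN,
      real_inner_comm ((T ∘ e.symm) y) ((principalNormal P θ ∘ T ∘ e.symm) y), g.inner_T_N]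
    ring
  -- The scalars `l, m` are chosen point by point, so continuity is taken from `⟪N, dT' u⟫ = m ⟪T',
  -- df u⟫`, whose nonvanishing forces `m ≠ 0`.
  have hcont : ContinuousOn (fun y ↦ ⟪(principalNormal P θ ∘ T ∘ e.symm) y,
      fderiv ℝ (T' ∘ e.symm) y u⟫) U :=
    hF.contDiffOn_N.continuousOn.inner
      ((hF.contDiffOn_T'.continuousOn_fderiv_of_isOpen hU.isOpen (by simp)).clm_apply
        continuousOn_const)
  set O := U ∩ (fun y ↦ ⟪(principalNormal P θ ∘ T ∘ e.symm) y,
      fderiv ℝ (T' ∘ e.symm) y u⟫) ⁻¹' {0}ᶜ with hO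
  have hOo : IsOpen O := hcont.isOpen_inter_preimage hU.isOpen isOpen_compl_singleton
  have hpO : e p ∈ O := by
    refine ⟨hpU, ?_⟩
    rw [Set.mem_preimage, hval _ hpU _ _ hs, hu, (hF.frame _ hpU).inner_self', mul_one]
    exact hm0
  have hVo : IsOpen (e.source ∩ e ⁻¹' O) := e.isOpen_inter_preimage hOo
  have hsub : e.source ∩ e ⁻¹' O ⊆ V := fun q hq ↦ by
    have := hm hq.2.1
    rwa [e.left_inv hq.1] at this
  refine ⟨e.source ∩ e ⁻¹' O, T, ⟨mem_chart_source _ _, hpO⟩, hT.mono hVo hsub, fun q hq ↦ ?_⟩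
  obtain ⟨l, m, hs⟩ := hA.exists_pullbackEqs hU hT hT' hm hq.2.1
  have hl : l = 0 := by
    refine (mul_eq_zero.mp (hA.mul_eq_zero_of_finrank hU hT hT' hm hq.2.1 hs (hN _))).resolve_right ?_
    rintro rfl
    refine hq.2.2 ?_
    exact (hval _ hq.2.1 _ _ hs).trans (zero_mul _)
  have := (hA.geodesic_iff hU hT hT' hm hq.2.1 hs).mpr hl
  rwa [e.left_inv hq.1] at this

/-- A composition without totally geodesic points has one-dimensional first normal spaces. -/
theorem ConstantAngles.finrank_of_composition [IsManifold (𝓡 2) ∞ M]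
    (hA : ConstantAngles i P θ θ') (hN : ∀ p, firstNormalSpace i p ≠ ⊥)
    (hc : IsSurfaceComposition i) (p : M) : Module.finrank ℝ (firstNormalSpace i p) = 1 := by
  obtain ⟨U, φ, hφ, ⟨x, hx, rfl⟩, hi, g, W, F, hg, hF, hgm, he⟩ := hc p
  obtain ⟨V, T, T', hpV, hT, hT'⟩ := hA.exists_principalFields (φ x)
  have hU' : IsOpen (U ∩ φ ⁻¹' V) :=
    hφ.continuousOn.isOpen_inter_preimage hi.1 hT.1.isOpen
  have hs : U ∩ φ ⁻¹' V ⊆ U := Set.inter_subset_left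
  have h : LocalParam i φ (U ∩ φ ⁻¹' V) :=
    ⟨hU', hφ.mono hs, fun y hy ↦ hi.injective_fderiv (hs hy)⟩
  have hm : Set.MapsTo φ (U ∩ φ ⁻¹' V) V := fun y hy ↦ hy.2
  have hx' : x ∈ U ∩ φ ⁻¹' V := ⟨hx, hpV⟩
  have hc' : IsCompositionOn (i ∘ φ) (U ∩ φ ⁻¹' V) :=
    ⟨⟨hU', hi.2.1.mono hs, fun y hy ↦ hi.2.2 y (hs hy)⟩, g, W, F,
      ⟨hU', hg.2.1.mono hs, fun y hy ↦ hg.2.2 y (hs hy)⟩, hF, hgm.mono_left hs, he.mono hs⟩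
  obtain ⟨l, m, hlm⟩ := hA.exists_pullbackEqs h hT hT' hm hx'
  have h0 := (hA.adaptedFrame h hT hT' hm).mul_eq_zero_of_composition hc'
    (fun y hy ↦ hA.exists_pullbackEqs h hT hT' hm hy) hx' hlm hA.angleCoeff_ne
    (neg_ne_zero.mpr hA.swap.angleCoeff_ne)
  have e := hA.firstNormalSpace_eq h hT hT' hm hx' hlm
  have line (z : Euc 4) (hz : firstNormalSpace i (φ x) = Submodule.span ℝ {z}) :
      Module.finrank ℝ (firstNormalSpace i (φ x)) = 1 := by
    rw [hz]
    refine finrank_span_singleton fun h0 ↦ hN (φ x) ?_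
    rw [hz, h0, Submodule.span_zero_singleton]
  rcases mul_eq_zero.mp h0 with rfl | rfl
  · rw [zero_smul, Submodule.span_insert_zero] at e
    exact line _ e
  · rw [zero_smul, Set.pair_comm, Submodule.span_insert_zero] at e
    exact line _ e

/-- If the first normal spaces are lines, then near every point one of the principal directions
is geodesic. -/
theorem ConstantAngles.exists_geodesic_or [IsManifold (𝓡 2) ∞ M] (hA : ConstantAngles i P θ θ')
    (hN : ∀ p, Module.finrank ℝ (firstNormalSpace i p) = 1) (p : M) :
    (∃ V T, p ∈ V ∧ IsPrincipalField i P θ V T ∧ IsGeodesicField i V T) ∨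
      ∃ V T, p ∈ V ∧ IsPrincipalField i P θ' V T ∧ IsGeodesicField i V T := by
  obtain ⟨V, T, T', hpV, hT, hT'⟩ := hA.exists_principalFields p
  obtain ⟨U, hU, -, hm, hpU⟩ := exists_localParam hA.immersion hT.1.isOpen hpV
  obtain ⟨l, m, hlm⟩ := hA.exists_pullbackEqs hU hT hT' hm hpU
  have e := hA.firstNormalSpace_eq hU hT hT' hm hpU hlm
  have h0 := hA.mul_eq_zero_of_finrank hU hT hT' hm hpU hlm (hN _)
  have hne : ¬ (l = 0 ∧ m = 0) := by
    rintro ⟨rfl, rfl⟩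
    rw [zero_smul, zero_smul, Set.pair_eq_singleton, Submodule.span_zero_singleton] at e
    have := hN ((chartAt (Euc 2) p).symm (chartAt (Euc 2) p p))
    rw [e, finrank_bot] at this
    exact zero_ne_one this
  rcases mul_eq_zero.mp h0 with rfl | rfl
  · exact Or.inl (hA.geodesic_of_eq_zero hN hT hT' hpV (fun h ↦ hne ⟨rfl, h⟩) hlm)
  · exact Or.inr (hA.swap.geodesic_of_eq_zero hN hT' hT hpV (fun h ↦ hne ⟨h, rfl⟩) hlm.swap)

/-- The two principal directions cannot both be geodesic near a point, unless the surface is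
totally geodesic there. -/
theorem ConstantAngles.not_both_geodesic [IsManifold (𝓡 2) ∞ M] (hA : ConstantAngles i P θ θ')
    {p : M} (hN : firstNormalSpace i p ≠ ⊥) {V V' : Set M} {T T' : M → Euc 4} (hp : p ∈ V)
    (hp' : p ∈ V') (hT : IsPrincipalField i P θ V T) (hg : IsGeodesicField i V T)
    (hT' : IsPrincipalField i P θ' V' T') (hg' : IsGeodesicField i V' T') : False := by
  have hV := hT.1.isOpen.inter hT'.1.isOpen
  replace hT := hT.mono hV Set.inter_subset_left
  replace hT' := hT'.mono hV Set.inter_subset_right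
  obtain ⟨U, hU, -, hm, hpU⟩ := exists_localParam hA.immersion hV ⟨hp, hp'⟩
  obtain ⟨l, m, hlm⟩ := hA.exists_pullbackEqs hU hT hT' hm hpU
  have hl := (hA.geodesic_iff hU hT hT' hm hpU hlm).mp (hg _ (hm hpU).1)
  have hm0 := (hA.swap.geodesic_iff hU hT' hT hm hpU hlm.swap).mp (hg' _ (hm hpU).2)
  have e := hA.firstNormalSpace_eq hU hT hT' hm hpU hlm
  rw [hl, hm0, (chartAt (Euc 2) p).left_inv (mem_chart_source _ _)] at e
  exact hN (by rw [e]; simp)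

/-- If the first normal spaces of a connected surface are lines, then one of the principal
directions is geodesic. -/
theorem ConstantAngles.geodesic_or [IsManifold (𝓡 2) ∞ M] [ConnectedSpace M]
    (hA : ConstantAngles i P θ θ')
    (hN : ∀ p, Module.finrank ℝ (firstNormalSpace i p) = 1) :
    PrincipalDirectionGeodesic i P θ ∨ PrincipalDirectionGeodesic i P θ' := by
  let Z (θ : ℝ) : Set M := {p | ∃ V T, p ∈ V ∧ IsPrincipalField i P θ V T ∧ IsGeodesicField i V T}
  have hZo (θ : ℝ) : IsOpen (Z θ) := by
    rw [isOpen_iff_mem_nhds]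
    rintro p ⟨V, T, hp, hT, hg⟩
    exact Filter.mem_of_superset (hT.1.isOpen.mem_nhds hp) fun q hq ↦ ⟨V, T, hq, hT, hg⟩
  -- The two sets are open, they cover `M` because one curvature vanishes near each point, and they
  -- are disjoint because both vanishing would give `N₁ = 0`.
  have hcompl : (Z θ)ᶜ = Z θ' := by
    ext p
    constructor
    · intro hp
      exact (hA.exists_geodesic_or hN p).resolve_left hp
    · rintro ⟨V', T', hp', hT', hg'⟩ ⟨V, T, hp, hT, hg⟩
      refine hA.not_both_geodesic (fun h ↦ ?_) hp hp' hT hg hT' hg'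
      have := hN p
      rw [h, finrank_bot] at this
      exact zero_ne_one this
  have hclopen : IsClopen (Z θ) := ⟨⟨by rw [hcompl]; exact hZo θ'⟩, hZo θ⟩
  rcases isClopen_iff.mp hclopen with h | h
  · right
    intro p
    have : p ∈ Z θ' := by rw [← hcompl, h]; simp
    exact this
  · left
    intro p
    have : p ∈ Z θ := by rw [h]; trivial
    exact this

/-- If a principal direction is geodesic, then the surface is a composition. -/
theorem ConstantAngles.composition_of_geodesic [IsManifold (𝓡 2) ∞ M]
    (hA : ConstantAngles i P θ θ') (hG : PrincipalDirectionGeodesic i P θ) :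
    IsSurfaceComposition i := by
  intro p
  obtain ⟨V, T, hp, hT, hg⟩ := hG p
  obtain ⟨V', T', hp', hT'⟩ := hA.swap.exists_principalField p
  have hV := hT.1.isOpen.inter hT'.1.isOpen
  replace hT := hT.mono hV Set.inter_subset_left
  replace hT' := hT'.mono hV Set.inter_subset_right
  obtain ⟨U, hU, -, hm, hpU⟩ := exists_localParam hA.immersion hV ⟨hp, hp'⟩
  obtain ⟨O, ψ, -, hψ, hψm, ⟨y, hy, hyp⟩, hc⟩ :=
    (hA.adaptedFrame hU hT hT' hm).exists_isCompositionOn (fun x hx ↦ by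
      obtain ⟨l, m, hlm⟩ := hA.exists_pullbackEqs hU hT hT' hm hx
      have hl := (hA.geodesic_iff hU hT hT' hm hx hlm).mp (hg _ (hm hx).1)
      subst hl
      exact ⟨m, hlm⟩) hpU
  refine ⟨O, (chartAt (Euc 2) p).symm ∘ ψ, hU.contMDiffOn.comp hψ.contMDiffOn hψm, ⟨y, hy, ?_⟩, hc⟩
  rw [Function.comp_apply, hyp, (chartAt (Euc 2) p).left_inv (mem_chart_source _ _)]

end Surface

/-! ### The equivalence -/

theorem mainTheorem8 {M : Type*} [TopologicalSpace M] [ChartedSpace (Euc 2) M]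
    [IsManifold (𝓡 2) ∞ M] [ConnectedSpace M]
    (i : M → Euc 4) (hi : IsSurfaceImmersion i)
    (P : Submodule ℝ (Euc 4)) (hP : Module.finrank ℝ P = 2)
    (θ₁ θ₂ : ℝ) (h₁ : 0 < θ₁) (h₁₂ : θ₁ < θ₂) (h₂ : θ₂ < Real.pi / 2)
    (hangles : ∀ p, ArePrincipalAngles (tangentPlane i p) P θ₁ θ₂)
    (hN : ∀ p, firstNormalSpace i p ≠ ⊥) :
    List.TFAE [
      IsSurfaceComposition i,
      ∀ p, Module.finrank ℝ (firstNormalSpace i p) = 1,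
      PrincipalDirectionGeodesic i P θ₁ ∨ PrincipalDirectionGeodesic i P θ₂] := by
  have hpi := Real.pi_pos
  have hc : Real.cos θ₂ < Real.cos θ₁ := Real.cos_lt_cos_of_nonneg_of_le_pi h₁.le (by linarith) h₁₂
  have hc₂ : 0 < Real.cos θ₂ := Real.cos_pos_of_mem_Ioo ⟨by linarith, h₂⟩
  have hA : ConstantAngles i P θ₁ θ₂ :=
    { immersion := hi
      finrank_eq := hP
      cos_ne := (hc₂.trans hc).ne'
      cos_ne' := hc₂.ne'
      sin_ne := (Real.sin_pos_of_pos_of_lt_pi h₁ (by linarith)).ne'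
      sin_ne' := (Real.sin_pos_of_pos_of_lt_pi (h₁.trans h₁₂) (by linarith)).ne'
      disc_ne := by
        rw [angleDisc_eq]
        exact (sub_pos.mpr (pow_lt_pow_left₀ hc hc₂.le two_ne_zero)).ne'
      exists_principal := fun p ↦ (hangles p).exists_principalVectors }
  tfae_have 1 → 2 := fun h p ↦ hA.finrank_of_composition hN h p
  tfae_have 2 → 3 := fun h ↦ hA.geodesic_or h
  tfae_have 3 → 1 := fun h ↦ h.elim hA.composition_of_geodesic hA.swap.composition_of_geodesic
  tfae_finish
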